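/- Let $G$ be a finite simple graph on $n$ vertices. Some vertices are colored blue and the others white. The skew color change rule is: if any vertex (blue or white) has exactly one white neighbor, then this neighbor becomes blue. A set $Z\subseteq V(G)$ is a skew zero forcing set if, starting with exactly the vertices of $Z$ blue, repeated application of the rule turns all vertices blue. Let $\lambda^-(G)$ be the number of integers $k$ for which there exist $Z,F\subseteq V(G)$ with $|Z|=|F|=k$ such that $Z$ is a skew zero forcing set and $F$ is not. Then $\lambda^-(G)=0$ if and only if $G$ is one of the following graphs. 1. The complete graph $K_n$. 2. The edgeless graph $\overline{K_n}$. 3. A doubly extended bouquet-dipole: for some $m\ge 0$ there are distinct vertices $u=s_0,s_1,\dots,s_{2m+1}=v$ such that $G$ consists of a nonempty set of odd cycles through $u$, a nonempty set of odd cycles through $v$ and, for each $0\le j\le 2m$, paths of even order (number of vertices) from $s_j$ to $s_{j+1}$, namely exactly one such path if $j$ is even and two or more if $j$ is odd. Here every vertex on these cycles and paths, other than $u$, respectively $v$, on its cycles and the two ends of each path, is different from all the $s_i$ and has degree two in $G$. 4. A collection of one or more odd cycles that share one vertex, any two of them having exactly this vertex in common. 5. A two-set perfectly orderable graph: $V(G)$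 can be partitioned into ordered sets $U=\{u_1,\dots,u_m\}$ and $W=\{w_1,\dots,w_m\}$ such that every neighbor of $u_i$ is some $w_j$ with $j\le i$, and $u_iw_i\in E(G)$ for all $i\in\{1,\dots,m\}$. -/

import Mathlib

/-- One application of the skew color change rule, `B` and `B'` being the sets of blue vertices
before and after: some vertex `u`, blue or white, has exactly one white neighbor `w`, and `w`
becomes blue. -/
def SkewColorChange {V : Type*} [DecidableEq V] (G : SimpleGraph V) (B B' : Finset V) : Prop :=
  ∃ u w : V, {x : V | G.Adj u x ∧ x ∉ B} = {w} ∧ B' = insert w B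

/-- `Z` is a skew zero forcing set: finitely many (possibly zero) applications of the skew color
change rule turn every vertex blue. -/
def IsSkewZeroForcing {V : Type*} [Fintype V] [DecidableEq V] (G : SimpleGraph V)
    (Z : Finset V) : Prop :=
  Relation.ReflTransGen (SkewColorChange G) Z Finset.univ

/-- The skew zero forcing span: the number of cardinalities `k` for which some `k`-set of vertices
is a skew zero forcing set and some `k`-set is not. -/
noncomputable def skewZeroForcingSpan {V : Type*} [Fintype V] [DecidableEq V]
    (G : SimpleGraph V) : ℕ :=
  Set.ncard {k : ℕ | ∃ Z F : Finset V, Z.card = k ∧ F.card = k ∧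
    IsSkewZeroForcing G Z ∧ ¬ IsSkewZeroForcing G F}

/-- `V` is partitioned into `u₁, …, uₘ` and `w₁, …, wₘ` such that every neighbor of `uᵢ` is some
`wⱼ` with `j ≤ i`, and `uᵢ` is adjacent to `wᵢ` for all `i`. -/
def IsTwoSetPerfectlyOrderable {V : Type*} (G : SimpleGraph V) : Prop :=
  ∃ (m : ℕ) (u w : Fin m → V),
    Function.Injective u ∧ Function.Injective w ∧
    Disjoint (Set.range u) (Set.range w) ∧ Set.range u ∪ Set.range w = Set.univ ∧
    (∀ (i : Fin m) (x : V), G.Adj (u i) x → ∃ j : Fin m, j ≤ i ∧ x = w j) ∧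
    ∀ i : Fin m, G.Adj (u i) (w i)

/-- `G` is the union of a nonempty collection `C` of odd cycles through a vertex `c`, any two of
which have exactly the vertex `c` in common. -/
def IsOddCycleBouquet {V : Type*} (G : SimpleGraph V) : Prop :=
  ∃ (c : V) (C : Set (G.Walk c c)),
    C.Nonempty ∧
    (∀ p ∈ C, p.IsCycle ∧ Odd p.length) ∧
    (∀ p ∈ C, ∀ q ∈ C, p ≠ q → {x | x ∈ p.support ∧ x ∈ q.support} = {c}) ∧
    (∀ x : V, ∃ p ∈ C, x ∈ p.support) ∧
    ∀ e ∈ G.edgeSet, ∃ p ∈ C, e ∈ p.edges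

/-- Distinct vertices `s 0, s 1, …, s (2m+1)` are given, with `u = s 0` and `v = s (2m+1)`.
The set `C` is a nonempty collection of odd cycles through `u`, and `D` is one through `v`.
For each `j ≤ 2m` the set `P j` consists of paths of even order (that is, odd length) from `s j`
to `s (j+1)`: of a single path if `j` is even, of at least two paths if `j` is odd.
Apart from the vertices named as base point or ends, all vertices on these cycles and paths are
different from all the `s j` and have degree two in `G`. The graph consists of these cycles and
paths. -/
def IsDoublyExtendedBouquetDipole {V : Type*} (G : SimpleGraph V) : Prop :=
  ∃ (m : ℕ) (s : Fin (2 * m + 1 + 1) → V)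
    (C : Set (G.Walk (s 0) (s 0)))
    (D : Set (G.Walk (s (Fin.last (2 * m + 1))) (s (Fin.last (2 * m + 1)))))
    (P : ∀ j : Fin (2 * m + 1), Set (G.Walk (s j.castSucc) (s j.succ))),
    Function.Injective s ∧
    C.Nonempty ∧ D.Nonempty ∧
    (∀ c ∈ C, c.IsCycle ∧ Odd c.length ∧ ∀ x ∈ c.support, x ≠ s 0 →
      x ∉ Set.range s ∧ (G.neighborSet x).ncard = 2) ∧
    (∀ d ∈ D, d.IsCycle ∧ Odd d.length ∧ ∀ x ∈ d.support, x ≠ s (Fin.last (2 * m + 1)) →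
      x ∉ Set.range s ∧ (G.neighborSet x).ncard = 2) ∧
    (∀ j, ∀ p ∈ P j, p.IsPath ∧ Odd p.length ∧
      ∀ x ∈ p.support, x ≠ s j.castSucc → x ≠ s j.succ →
        x ∉ Set.range s ∧ (G.neighborSet x).ncard = 2) ∧
    (∀ j : Fin (2 * m + 1), Even (j : ℕ) → ∃ p, P j = {p}) ∧
    (∀ j : Fin (2 * m + 1), Odd (j : ℕ) → (P j).Nontrivial) ∧
    (∀ x : V, (∃ c ∈ C, x ∈ c.support) ∨ (∃ d ∈ D, x ∈ d.support) ∨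
      ∃ j, ∃ p ∈ P j, x ∈ p.support) ∧
    ∀ e ∈ G.edgeSet, (∃ c ∈ C, e ∈ c.edges) ∨ (∃ d ∈ D, e ∈ d.edges) ∨
      ∃ j, ∃ p ∈ P j, e ∈ p.edges

/-! A set is forcing exactly when it meets every skew fort, so the non-forcing sets are those whose
complement contains one. Let `n` be the number of vertices and `f` the smallest size of a skew fort.
The span vanishes if and only if there are no skew forts or every set of size `f` is one. This
leaves four cases.

No skew forts: some vertex is a leaf, and deleting it together with its neighbor keeps the graph
free of skew forts. The deleted pairs, in order of deletion, form the two-set perfect order.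

`f = 1`: every singleton is a skew fort, so there are no edges.

`2 ≤ f < n`: put `t = n - f + 2`. All degrees are at least `t`, and any `t - 1` vertices have a
common neighbor of degree exactly `t`. Counting leaves only `t = n - 1`, `t = n - 2` and `t = 3`,
and the last two are excluded by hand (`eq_top_of_uniform`).

`f = n ≥ 2`: the vertex set is the only skew fort. A skew fort contains both or neither of the two
neighbors of a degree-two vertex, so it is a union of link classes. There are at least as many
classes as branch vertices (those of degree other than two). If there are several classes,
minimality supplies for each class a branch vertex with all neighbors but one in that class. Hence
classes and branch vertices correspond, and each branch vertex has one exceptional, thin edge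
(`nonempty_thinEdges`). The threads joining branch vertices are odd; following them along thin and
along ordinary edges gives two involutions `θ` and `ρ` of the branch set (`exists_pairing`). By
minimality `ρ ∘ θ` is transitive, which forces the dihedral picture of a chain whose links alternate
between `θ` and `ρ`, with `ρ` fixing both ends. That chain is the dipole, and the fixed points carry
the odd cycles. If there is a single class, at most one branch vertex exists and the graph is a
bouquet.

Conversely, membership in a skew fort is transported along odd threads, which shows that bouquets
and dipoles have no skew fort but the whole vertex set. -/

/-! ### Skew forts and the vanishing of the span -/

/-- A skew fort: a nonempty set of vertices such that no vertex of the graph has exactly one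
neighbor in it. -/
def IsSkewFort {V : Type*} (G : SimpleGraph V) (F : Set V) : Prop :=
  F.Nonempty ∧ ∀ u, ∀ w ∈ F, G.Adj u w → ∃ w' ∈ F, w' ≠ w ∧ G.Adj u w'

/-- If `F` is nonempty and not a skew fort, some vertex has exactly one neighbor in `F`. -/
theorem exists_unique_adj_of_not_isSkewFort {V : Type*} {G : SimpleGraph V} {F : Set V}
    (hne : F.Nonempty) (h : ¬ IsSkewFort G F) :
    ∃ u, ∃ w ∈ F, G.Adj u w ∧ ∀ w' ∈ F, G.Adj u w' → w' = w := by
  unfold IsSkewFort at h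
  push Not at h
  obtain ⟨u, w, hw, huw, hu⟩ := h hne
  refine ⟨u, w, hw, huw, fun w' hw' ha => ?_⟩
  by_contra hne
  exact hu w' hw' hne ha

/-- A set is skew zero forcing if and only if it meets every skew fort. -/
theorem isSkewZeroForcing_iff {V : Type*} [Fintype V] [DecidableEq V] {G : SimpleGraph V}
    {Z : Finset V} :
    IsSkewZeroForcing G Z ↔ ∀ F : Set V, IsSkewFort G F → ∃ x ∈ Z, x ∈ F := by
  constructor
  · intro h F hF
    by_contra hcon
    push Not at hcon
    have key : ∀ B : Finset V, Relation.ReflTransGen (SkewColorChange G) Z B →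
        ∀ x ∈ B, x ∉ F := by
      intro B hB
      induction hB with
      | refl => exact hcon
      | tail _ hstep ih =>
        obtain ⟨u, w, huw, rfl⟩ := hstep
        intro x hx hxF
        rcases Finset.mem_insert.1 hx with rfl | hx
        · have hux : G.Adj u x := (huw.symm.subset (Set.mem_singleton x)).1
          obtain ⟨w', hw', hne, ha⟩ := hF.2 u x hxF hux
          exact hne (huw.subset ⟨ha, fun hb => ih w' hb hw'⟩)
        · exact ih x hx hxF
    obtain ⟨x, hx⟩ := hF.1
    exact key _ h x (Finset.mem_univ x) hx
  · intro h
    induction hn : (Zᶜ).card using Nat.strong_induction_on generalizing Z with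
    | _ n ih =>
      by_cases hZ : Z = Finset.univ
      · rw [hZ]
        exact Relation.ReflTransGen.refl
      have hne : ({x | x ∉ Z} : Set V).Nonempty := by
        by_contra hcon
        rw [Set.not_nonempty_iff_eq_empty, Set.eq_empty_iff_forall_notMem] at hcon
        exact hZ (Finset.eq_univ_iff_forall.2 fun x => not_not.1 (hcon x))
      -- The white set misses `Z`, so it cannot be a skew fort; a vertex with exactly one neighbor
      -- in it performs the next force.
      have hnf : ¬ IsSkewFort G {x | x ∉ Z} := by
        intro hF
        obtain ⟨x, hx, hx'⟩ := h _ hF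
        exact hx' hx
      obtain ⟨u, w, hw, huw, hu⟩ := exists_unique_adj_of_not_isSkewFort hne hnf
      have hstep : SkewColorChange G Z (insert w Z) := by
        refine ⟨u, w, ?_, rfl⟩
        ext x
        constructor
        · rintro ⟨h1, h2⟩
          exact hu x h2 h1
        · rintro rfl
          exact ⟨huw, hw⟩
      refine Relation.ReflTransGen.head hstep (ih _ ?_ ?_ rfl)
      · rw [← hn]
        apply Finset.card_lt_card
        rw [Finset.compl_ssubset_compl]
        exact Finset.ssubset_insert hw
      · intro F hF
        obtain ⟨x, hx, hx'⟩ := h F hF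
        exact ⟨x, Finset.mem_insert_of_mem hx, hx'⟩

/-- The span vanishes if and only if forcing depends on the cardinality only. -/
theorem skewZeroForcingSpan_eq_zero_iff_forall {V : Type*} [Fintype V] [DecidableEq V]
    {G : SimpleGraph V} :
    skewZeroForcingSpan G = 0 ↔ ∀ Z F : Finset V, Z.card = F.card →
      IsSkewZeroForcing G Z → IsSkewZeroForcing G F := by
  unfold skewZeroForcingSpan
  -- Finiteness is needed because `Set.ncard` is also zero on infinite sets.
  rw [Set.ncard_eq_zero ((Set.finite_Iic (Fintype.card V)).subset (by
    rintro k ⟨Z, F, rfl, -⟩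
    exact Finset.card_le_univ Z)), Set.eq_empty_iff_forall_notMem]
  constructor
  · intro h Z F hc hZ
    by_contra hF
    exact h F.card ⟨Z, F, hc, rfl, hZ, hF⟩
  · rintro h k ⟨Z, F, rfl, hc, hZ, hF⟩
    exact hF (h Z F hc.symm hZ)

/-- The span vanishes if and only if there are no skew forts or, for the smallest size `f` of
a skew fort, every set of size `f` is a skew fort. -/
theorem skewZeroForcingSpan_eq_zero_iff {V : Type*} [Fintype V] [DecidableEq V]
    {G : SimpleGraph V} :
    skewZeroForcingSpan G = 0 ↔ (∀ F, ¬ IsSkewFort G F) ∨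
      ∃ f, 1 ≤ f ∧ f ≤ Fintype.card V ∧ (∀ S : Finset V, S.card = f → IsSkewFort G (S : Set V)) ∧
        ∀ S : Finset V, IsSkewFort G (S : Set V) → f ≤ S.card := by
  classical
  rw [skewZeroForcingSpan_eq_zero_iff_forall]
  constructor
  · intro h
    by_cases hno : ∀ F, ¬ IsSkewFort G F
    · exact Or.inl hno
    right
    push Not at hno
    obtain ⟨F₀, hF₀⟩ := hno
    have hex : ∃ f, ∃ S : Finset V, IsSkewFort G (S : Set V) ∧ S.card = f :=
      ⟨_, F₀.toFinset, by simpa using hF₀, rfl⟩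
    obtain ⟨S₀, hS₀, hc₀⟩ := Nat.find_spec hex
    have hmin : ∀ S : Finset V, IsSkewFort G (S : Set V) → Nat.find hex ≤ S.card :=
      fun S hS => Nat.find_min' hex ⟨S, hS, rfl⟩
    refine ⟨Nat.find hex, ?_, ?_, ?_, hmin⟩
    · rw [← hc₀]
      obtain ⟨x, hx⟩ := hS₀.1
      exact Finset.card_pos.2 ⟨x, hx⟩
    · rw [← hc₀]
      exact Finset.card_le_univ S₀
    -- The complement of the minimum skew fort `S₀` is not forcing, hence neither is that of `S`. So
    -- `S` contains a skew fort, which by minimality of the size is all of `S`.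
    · intro S hS
      have hnotforce : ¬ IsSkewZeroForcing G S₀ᶜ := by
        rw [isSkewZeroForcing_iff]
        intro hf
        obtain ⟨x, hx, hx'⟩ := hf _ hS₀
        exact (Finset.mem_compl.1 hx) hx'
      have hS' : ¬ IsSkewZeroForcing G Sᶜ := fun hf =>
        hnotforce (h Sᶜ S₀ᶜ (by rw [Finset.card_compl, Finset.card_compl, hS, hc₀]) hf)
      rw [isSkewZeroForcing_iff] at hS'
      push Not at hS'
      obtain ⟨F, hF, hFS⟩ := hS'
      have hsub : F.toFinset ⊆ S := by
        intro x hx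
        by_contra hxS
        exact hFS x (Finset.mem_compl.2 hxS) (Set.mem_toFinset.1 hx)
      have hle := hmin F.toFinset (by simpa using hF)
      have heq := Finset.eq_of_subset_of_card_le hsub (hS ▸ hle)
      rw [← heq]
      simpa using hF
  · rintro (hno | ⟨f, hf1, hfn, hall, hmin⟩) Z F hc hZ
    · rw [isSkewZeroForcing_iff]
      exact fun F hF => absurd hF (hno F)
    · rw [isSkewZeroForcing_iff] at hZ ⊢
      intro X hX
      by_contra hcon
      push Not at hcon
      have h1 : f ≤ X.toFinset.card := hmin _ (by simpa using hX)
      have h2 : X.toFinset.card ≤ (Fᶜ).card := Finset.card_le_card fun x hx =>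
        Finset.mem_compl.2 fun hxF => hcon x hxF (Set.mem_toFinset.1 hx)
      -- A skew fort missed by `F` shows that the complement of `F`, and so that of `Z`, has at
      -- least `f` elements. Any `f` of them form a skew fort missed by `Z`.
      have h3 : f ≤ (Zᶜ).card := by
        rw [Finset.card_compl] at h2 ⊢
        omega
      obtain ⟨S, hS, hSc⟩ := Finset.exists_subset_card_eq h3
      obtain ⟨x, hx, hx'⟩ := hZ _ (hall S hSc)
      exact (Finset.mem_compl.1 (hS hx')) hx

/-! ### Graphs without skew forts -/

/-- A two-set perfectly orderable graph has no skew forts. -/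
theorem not_isSkewFort_of_isTwoSetPerfectlyOrderable {V : Type*} {G : SimpleGraph V}
    (h : IsTwoSetPerfectlyOrderable G) (F : Set V) : ¬ IsSkewFort G F := by
  obtain ⟨m, u, w, hu, hw, hdisj, hcov, hnb, hadj⟩ := h
  intro hF
  -- Upward induction: the neighbors of `u i` other than `w i` are earlier `w j`, already known to
  -- be outside `F`.
  have hwF : ∀ i, w i ∉ F := by
    intro i
    induction i using WellFoundedLT.induction with
    | _ i ih =>
      intro hi
      obtain ⟨x, hx, hne, ha⟩ := hF.2 (u i) (w i) hi (hadj i)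
      obtain ⟨j, hj, rfl⟩ := hnb i x ha
      exact ih j (lt_of_le_of_ne hj fun h => hne (h ▸ rfl)) hx
  -- Downward induction: the neighbors of `w i` are vertices `w k`, which are outside `F`, or `u k`
  -- with `k ≥ i`.
  have huF : ∀ i, u i ∉ F := by
    intro i
    induction i using WellFoundedGT.induction with
    | _ i ih =>
      intro hi
      obtain ⟨x, hx, hne, ha⟩ := hF.2 (w i) (u i) hi (hadj i).symm
      have hx' : x ∈ Set.range u ∪ Set.range w := hcov ▸ Set.mem_univ x
      rcases hx' with ⟨k, rfl⟩ | ⟨k, rfl⟩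
      · obtain ⟨j, hj, hj'⟩ := hnb k (w i) ha.symm
        obtain rfl := hw hj'
        exact ih k (lt_of_le_of_ne hj fun h => hne (h ▸ rfl)) hx
      · exact hwF k hx
  obtain ⟨x, hx⟩ := hF.1
  have hx' : x ∈ Set.range u ∪ Set.range w := hcov ▸ Set.mem_univ x
  rcases hx' with ⟨k, rfl⟩ | ⟨k, rfl⟩
  · exact huF k hx
  · exact hwF k hx

/-- Leaf elimination: a vertex set without relative skew forts admits a two-set perfect order. -/
theorem exists_order_of_forall_not_fort {V : Type*} [DecidableEq V] (G : SimpleGraph V) (n : ℕ) :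
    ∀ A : Finset V, A.card = n →
      (∀ F ⊆ A, F.Nonempty → ∃ u ∈ A, ∃ x ∈ F, G.Adj u x ∧ ∀ y ∈ F, G.Adj u y → y = x) →
      ∃ (m : ℕ) (u w : Fin m → V), Function.Injective u ∧ Function.Injective w ∧
        Disjoint (Set.range u) (Set.range w) ∧ Set.range u ∪ Set.range w = (A : Set V) ∧
        (∀ (i : Fin m), ∀ x ∈ A, G.Adj (u i) x → ∃ j : Fin m, j ≤ i ∧ x = w j) ∧
        ∀ i : Fin m, G.Adj (u i) (w i) := by
  induction n using Nat.strong_induction_on with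
  | _ n ih =>
    intro A hA hfort
    rcases A.eq_empty_or_nonempty with rfl | hne
    · exact ⟨0, Fin.elim0, Fin.elim0, fun i => i.elim0, fun i => i.elim0, by simp, by simp,
        fun i => i.elim0, fun i => i.elim0⟩
    obtain ⟨a, haA, b, hbA, hab, hb⟩ := hfort A subset_rfl hne
    have hne_ab : a ≠ b := hab.ne
    -- Inside `A` the vertex `a` is a leaf with neighbor `b`. The pair becomes the first of the
    -- order: later `u i` may be adjacent to `b`, but not to `a`.
    set A' := (A.erase a).erase b with hA'
    have hmem : ∀ x, x ∈ A' ↔ x ≠ b ∧ x ≠ a ∧ x ∈ A := by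
      intro x
      simp [hA']
    have hlt : A'.card < n := by
      rw [← hA]
      apply Finset.card_lt_card
      exact (Finset.erase_subset _ _).trans_ssubset (Finset.erase_ssubset haA)
    have hfort' : ∀ F ⊆ A', F.Nonempty →
        ∃ u ∈ A', ∃ x ∈ F, G.Adj u x ∧ ∀ y ∈ F, G.Adj u y → y = x := by
      intro F hF hFne
      have hFA : F ⊆ A := fun x hx => ((hmem x).1 (hF hx)).2.2
      have hbF : b ∉ F := fun h => ((hmem b).1 (hF h)).1 rfl
      have haF : a ∉ F := fun h => ((hmem a).1 (hF h)).2.1 rfl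
      have hua : ∀ x ∈ F, ¬ G.Adj a x := fun x hx h => hbF (hb x (hFA hx) h ▸ hx)
      obtain ⟨u, huA, x, hx, hux, huniq⟩ := hfort F hFA hFne
      by_cases hub : u = b
      -- If the witness for `F` is the deleted vertex `b`, enlarge `F` by `a`. Then `b` sees two
      -- elements, so the new witness is another vertex; it is not adjacent to `a`, whose only
      -- neighbor is `b`, and therefore serves for `F` as well.
      · subst hub
        obtain ⟨v, hvA, y, hy, hvy, hvuniq⟩ := hfort (insert a F)
          (Finset.insert_subset haA hFA) (Finset.insert_nonempty _ _)
        have hvb : v ≠ u := by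
          rintro rfl
          have h1 := hvuniq a (Finset.mem_insert_self _ _) hab.symm
          have h2 := hvuniq x (Finset.mem_insert_of_mem hx) hux
          exact haF (by rw [h1, ← h2]; exact hx)
        have hyF : y ∈ F := by
          rcases Finset.mem_insert.1 hy with rfl | h
          · exact absurd (hb v hvA hvy.symm) hvb
          · exact h
        have hva : v ≠ a := by
          rintro rfl
          exact hua y hyF hvy
        exact ⟨v, (hmem v).2 ⟨hvb, hva, hvA⟩, y, hyF, hvy,
          fun z hz => hvuniq z (Finset.mem_insert_of_mem hz)⟩
      · have hva : u ≠ a := by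
          rintro rfl
          exact hua x hx hux
        exact ⟨u, (hmem u).2 ⟨hub, hva, huA⟩, x, hx, hux, huniq⟩
    obtain ⟨m, u, w, hu, hw, hdisj, hcov, hnb, hadj⟩ := ih _ hlt A' rfl hfort'
    have huA : ∀ i, u i ∈ A' := fun i => by
      have : u i ∈ (A' : Set V) := hcov ▸ Or.inl ⟨i, rfl⟩
      exact this
    have hwA : ∀ i, w i ∈ A' := fun i => by
      have : w i ∈ (A' : Set V) := hcov ▸ Or.inr ⟨i, rfl⟩
      exact this
    refine ⟨m + 1, Fin.cons a u, Fin.cons b w, ?_, ?_, ?_, ?_, ?_, ?_⟩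
    · rw [Fin.cons_injective_iff]
      exact ⟨fun ⟨i, hi⟩ => ((hmem _).1 (huA i)).2.1 hi, hu⟩
    · rw [Fin.cons_injective_iff]
      exact ⟨fun ⟨i, hi⟩ => ((hmem _).1 (hwA i)).1 hi, hw⟩
    · rw [Fin.range_cons, Fin.range_cons, Set.disjoint_iff_forall_ne]
      rintro x (rfl | ⟨i, rfl⟩) y (rfl | ⟨j, rfl⟩)
      · exact hne_ab
      · exact fun h => ((hmem _).1 (hwA j)).2.1 h.symm
      · exact ((hmem _).1 (huA i)).1
      · exact fun h => Set.disjoint_left.1 hdisj ⟨i, rfl⟩ ⟨j, h.symm⟩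
    · rw [Fin.range_cons, Fin.range_cons]
      ext x
      have hx : x ∈ Set.range u ∪ Set.range w ↔ x ∈ A' := by
        rw [hcov]
        rfl
      rw [hmem, Set.mem_union] at hx
      simp only [Set.mem_union, Set.mem_insert_iff, Finset.mem_coe]
      by_cases h1 : x = a
      · simp [h1, haA]
      by_cases h2 : x = b
      · simp [h2, hbA]
      tauto
    · intro i x hxA hix
      induction i using Fin.cases with
      | zero => exact ⟨0, le_rfl, hb x hxA (by simpa using hix)⟩
      | succ i =>
        rw [Fin.cons_succ] at hix
        by_cases hxb : x = b
        · exact ⟨0, Fin.zero_le _, by simpa using hxb⟩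
        have hxa : x ≠ a := by
          rintro rfl
          exact ((hmem _).1 (huA i)).1 (hb _ ((hmem _).1 (huA i)).2.2 hix.symm)
        obtain ⟨j, hj, hxj⟩ := hnb i x ((hmem x).2 ⟨hxb, hxa, hxA⟩) hix
        exact ⟨j.succ, Fin.succ_le_succ_iff.2 hj, by simpa using hxj⟩
    · intro i
      induction i using Fin.cases with
      | zero => simpa using hab
      | succ i => simpa using hadj i

/-- A finite graph has no skew forts if and only if it is two-set perfectly orderable. -/
theorem forall_not_isSkewFort_iff {V : Type*} [Fintype V] [DecidableEq V] {G : SimpleGraph V} :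
    (∀ F, ¬ IsSkewFort G F) ↔ IsTwoSetPerfectlyOrderable G := by
  refine ⟨fun h => ?_, fun h F => not_isSkewFort_of_isTwoSetPerfectlyOrderable h F⟩
  obtain ⟨m, u, w, h1, h2, h3, h4, h5, h6⟩ := exists_order_of_forall_not_fort G _ Finset.univ rfl
    (fun F _ hF => by
      obtain ⟨u, x, hx, h⟩ := exists_unique_adj_of_not_isSkewFort (F := (F : Set V)) hF (h F)
      exact ⟨u, Finset.mem_univ u, x, hx, h⟩)
  exact ⟨m, u, w, h1, h2, h3, by simpa using h4, fun i x => h5 i x (Finset.mem_univ x), h6⟩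

/-! ### Complete and edgeless graphs -/

/-- A graph invariant under all permutations of its vertices has skew zero forcing span zero. -/
theorem skewZeroForcingSpan_eq_zero_of_perm {V : Type*} [Fintype V] [DecidableEq V]
    {G : SimpleGraph V} (hG : ∀ (σ : Equiv.Perm V) (a b : V), G.Adj (σ a) (σ b) ↔ G.Adj a b) :
    skewZeroForcingSpan G = 0 := by
  rw [skewZeroForcingSpan_eq_zero_iff_forall]
  intro Z F hc hZ
  rw [isSkewZeroForcing_iff] at hZ ⊢
  intro X hX
  have e : {x // x ∈ Z} ≃ {x // x ∈ F} := Finset.equivOfCardEq hc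
  let σ : Equiv.Perm V := e.extendSubtype
  have hσ : ∀ x ∈ Z, σ x ∈ F := fun x hx => Equiv.extendSubtype_mem e x hx
  have hfort : IsSkewFort G {x | σ x ∈ X} := by
    refine ⟨?_, ?_⟩
    · obtain ⟨x, hx⟩ := hX.1
      exact ⟨σ.symm x, by simpa using hx⟩
    · intro u w hw huw
      obtain ⟨w', hw', hne, ha⟩ := hX.2 (σ u) (σ w) hw ((hG σ u w).2 huw)
      refine ⟨σ.symm w', by simpa using hw', fun h => hne (by simp [← h]), ?_⟩
      rw [← hG σ]
      simpa using ha
  obtain ⟨x, hx, hx'⟩ := hZ _ hfort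
  exact ⟨σ x, hσ x hx, hx'⟩

theorem skewZeroForcingSpan_top {V : Type*} [Fintype V] [DecidableEq V] :
    skewZeroForcingSpan (⊤ : SimpleGraph V) = 0 :=
  skewZeroForcingSpan_eq_zero_of_perm fun σ a b => by simp

theorem skewZeroForcingSpan_bot {V : Type*} [Fintype V] [DecidableEq V] :
    skewZeroForcingSpan (⊥ : SimpleGraph V) = 0 :=
  skewZeroForcingSpan_eq_zero_of_perm fun σ a b => by simp

/-! ### All sets of some size strictly between one and the number of vertices are minimum skew forts
-/

section Uniform

variable {V : Type*} [Fintype V] [DecidableEq V] {G : SimpleGraph V} [DecidableRel G.Adj]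

/-- If every set of size `f` is a skew fort and there are no isolated vertices, degrees are
large. -/
theorem le_degree_of_forall_isSkewFort {f : ℕ} (hf : 1 ≤ f)
    (hall : ∀ S : Finset V, S.card = f → IsSkewFort G (S : Set V)) {x w : V} (hxw : G.Adj x w) :
    Fintype.card V + 2 ≤ G.degree x + f := by
  by_contra hlt
  -- With a smaller degree, `x` would have `f - 1` non-neighbors (itself counted); together with `w`
  -- they form an `f`-set in which `x` has exactly one neighbor.
  have hc : f - 1 ≤ ((G.neighborFinset x)ᶜ).card := by
    rw [Finset.card_compl, G.card_neighborFinset_eq_degree]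
    omega
  obtain ⟨R, hR, hRc⟩ := Finset.exists_subset_card_eq hc
  have hwR : w ∉ R := fun h => by
    have := Finset.mem_compl.1 (hR h)
    rw [SimpleGraph.mem_neighborFinset] at this
    exact this hxw
  obtain ⟨w', hw', hne, ha⟩ := (hall (insert w R) (by
    rw [Finset.card_insert_of_notMem hwR]
    omega)).2 x w (by simp) hxw
  rcases Finset.mem_insert.1 (Finset.mem_coe.1 hw') with h | h
  · exact hne h
  · have := Finset.mem_compl.1 (hR h)
    rw [SimpleGraph.mem_neighborFinset] at this
    exact this ha

/-- If all degrees are at least `t` and no set of `n - t + 1` vertices is a skew fort, then any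
`t - 1` vertices have a common neighbor of degree `t`. -/
theorem exists_common_neighbor {t : ℕ} (hdeg : ∀ x, t ≤ G.degree x)
    (hnf : ∀ S : Finset V, S.card + t = Fintype.card V + 1 → ¬ IsSkewFort G (S : Set V))
    (T : Finset V) (hT : T.card + 1 = t) (hTn : T.card < Fintype.card V) :
    ∃ x, G.degree x = t ∧ ∀ y ∈ T, G.Adj x y := by
  have hne : ((Tᶜ : Finset V) : Set V).Nonempty := by
    rw [Finset.coe_nonempty, ← Finset.card_pos, Finset.card_compl]
    omega
  -- The complement of `T` has `n - t + 1` elements. A vertex with a single neighbor there has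
  -- degree at most `t`, hence exactly `t`, and must be adjacent to all of `T`.
  obtain ⟨u, w, hw, huw, huniq⟩ := exists_unique_adj_of_not_isSkewFort hne
    (hnf Tᶜ (by rw [Finset.card_compl]; omega))
  have hwT : w ∉ T := Finset.mem_compl.1 (Finset.mem_coe.1 hw)
  have hsub : G.neighborFinset u ⊆ insert w T := by
    intro y hy
    rw [SimpleGraph.mem_neighborFinset] at hy
    by_cases hyT : y ∈ T
    · exact Finset.mem_insert_of_mem hyT
    · rw [huniq y (by simpa using hyT) hy]
      exact Finset.mem_insert_self _ _
  have hci : (insert w T).card = t := by rw [Finset.card_insert_of_notMem hwT, hT]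
  have heq : G.neighborFinset u = insert w T := by
    apply Finset.eq_of_subset_of_card_le hsub
    rw [hci, G.card_neighborFinset_eq_degree]
    exact hdeg u
  refine ⟨u, ?_, fun y hy => ?_⟩
  · rw [← G.card_neighborFinset_eq_degree, heq, hci]
  · rw [← SimpleGraph.mem_neighborFinset, heq]
    exact Finset.mem_insert_of_mem hy

/-- A step of the classification for degree three: the neighbor `a` of `v` is adjacent to the other
two neighbors. -/
theorem false_of_common_neighbor_three_aux (hdeg : ∀ x, 3 ≤ G.degree x)
    (hn : 6 ≤ Fintype.card V) {v a b c : V} (hv : G.neighborFinset v = {a, b, c})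
    (hab' : a ≠ b) (hac' : a ≠ c) (hbc' : b ≠ c)
    (hcom : ∀ y, y ≠ v → ∃ x, G.degree x = 3 ∧ G.Adj x v ∧ G.Adj x y)
    (hab : G.Adj a b) (hac : G.Adj a c) : False := by
  have hN : ∀ x, G.Adj v x ↔ x = a ∨ x = b ∨ x = c := fun x => by
    rw [← SimpleGraph.mem_neighborFinset, hv]
    simp
  have hva : G.Adj v a := (hN a).2 (by simp)
  have hvb : G.Adj v b := (hN b).2 (by simp)
  have hvc : G.Adj v c := (hN c).2 (by simp)
  have hthree : ∀ x p q r : V, G.degree x = 3 → p ≠ q → p ≠ r → q ≠ r → G.Adj x p → G.Adj x q →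
      G.Adj x r → ∀ y, G.Adj x y → y = p ∨ y = q ∨ y = r := by
    intro x p q r hx hpq hpr hqr h1 h2 h3 y hy
    have hsub : ({p, q, r} : Finset V) ⊆ G.neighborFinset x := by
      intro z hz
      rw [SimpleGraph.mem_neighborFinset]
      simp only [Finset.mem_insert, Finset.mem_singleton] at hz
      rcases hz with rfl | rfl | rfl <;> assumption
    have heq := Finset.eq_of_subset_of_card_le hsub (by
      rw [G.card_neighborFinset_eq_degree, hx, Finset.card_eq_three.2 ⟨p, q, r, hpq, hpr, hqr, rfl⟩])
    have : y ∈ ({p, q, r} : Finset V) := by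
      rw [heq, SimpleGraph.mem_neighborFinset]
      exact hy
    simpa using this
  have hsmall : ∀ p q r s u : V, ¬ ∀ y, y = p ∨ y = q ∨ y = r ∨ y = s ∨ y = u := by
    intro p q r s u h
    have h1 : (Finset.univ : Finset V) ⊆ {p, q, r, s, u} := fun y _ => by simpa using h y
    have h2 := (Finset.card_le_card h1).trans Finset.card_le_five
    rw [Finset.card_univ] at h2
    omega
  -- A common neighbor of `v` and `y` is one of `a`, `b`, `c`, so the neighborhoods of those of
  -- degree three cover everything but `v`.
  have hcover : ∀ y, y ≠ v → (G.degree a = 3 ∧ G.Adj a y) ∨ (G.degree b = 3 ∧ G.Adj b y) ∨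
      (G.degree c = 3 ∧ G.Adj c y) := by
    intro y hy
    obtain ⟨x, hx, hxv, hxy⟩ := hcom y hy
    rcases (hN x).1 hxv.symm with rfl | rfl | rfl
    · exact Or.inl ⟨hx, hxy⟩
    · exact Or.inr (Or.inl ⟨hx, hxy⟩)
    · exact Or.inr (Or.inr ⟨hx, hxy⟩)
  -- If `a` has degree three, its neighbors are `v`, `b`, `c`, and `b` and `c` contribute at most
  -- one new vertex each. So there are at most six vertices.
  by_cases ha3 : G.degree a = 3
  · have hNa := hthree a v b c ha3 hvb.ne hvc.ne hbc' hva.symm hab hac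
    have hfourth : ∀ x, G.Adj x v → G.Adj x a → G.degree x = 3 →
        ∃ y, ∀ z, G.Adj x z → z = v ∨ z = a ∨ z = y := by
      intro x hxv hxa hx
      have : ∃ y, G.Adj x y ∧ y ≠ v ∧ y ≠ a := by
        by_contra hcon
        push Not at hcon
        have hsub : G.neighborFinset x ⊆ {v, a} := by
          intro z hz
          rw [SimpleGraph.mem_neighborFinset] at hz
          by_cases hzv : z = v
          · simp [hzv]
          · simp [hcon z hz hzv]
        have := (Finset.card_le_card hsub).trans Finset.card_le_two
        rw [G.card_neighborFinset_eq_degree] at this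
        omega
      obtain ⟨y, hxy, hyv, hya⟩ := this
      exact ⟨y, hthree x v a y hx hva.ne hyv.symm hya.symm hxv hxa hxy⟩
    by_cases hb3 : G.degree b = 3
    swap
    · by_cases hc3 : G.degree c = 3
      · obtain ⟨z, hz⟩ := hfourth c hvc.symm hac.symm hc3
        apply hsmall v a b c z
        intro y
        by_cases hyv : y = v
        · exact Or.inl hyv
        rcases hcover y hyv with ⟨_, h⟩ | ⟨h, _⟩ | ⟨_, h⟩
        · have := hNa y h
          tauto
        · exact absurd h hb3
        · have := hz y h
          tauto
      · apply hsmall v a b c c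
        intro y
        by_cases hyv : y = v
        · exact Or.inl hyv
        rcases hcover y hyv with ⟨_, h⟩ | ⟨h, _⟩ | ⟨h, _⟩
        · have := hNa y h
          tauto
        · exact absurd h hb3
        · exact absurd h hc3
    obtain ⟨y, hy⟩ := hfourth b hvb.symm hab.symm hb3
    by_cases hc3 : G.degree c = 3
    swap
    · apply hsmall v a b c y
      intro x
      by_cases hxv : x = v
      · exact Or.inl hxv
      rcases hcover x hxv with ⟨_, h⟩ | ⟨_, h⟩ | ⟨h, _⟩
      · have := hNa x h
        tauto
      · have := hy x h
        tauto
      · exact absurd h hc3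
    obtain ⟨z, hz⟩ := hfourth c hvc.symm hac.symm hc3
    have hall : ∀ x, x = v ∨ x = a ∨ x = b ∨ x = c ∨ x = y ∨ x = z := by
      intro x
      by_cases hxv : x = v
      · exact Or.inl hxv
      rcases hcover x hxv with ⟨_, h⟩ | ⟨_, h⟩ | ⟨_, h⟩
      · have := hNa x h
        tauto
      · have := hy x h
        tauto
      · have := hz x h
        tauto
    have hne : ∀ p ∈ ({v, a, b, c, z} : Finset V), y ≠ p := by
      rintro p hp rfl
      simp only [Finset.mem_insert, Finset.mem_singleton] at hp
      apply hsmall v a b c z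
      intro x
      rcases hall x with h | h | h | h | h | h
      · exact Or.inl h
      · exact Or.inr (Or.inl h)
      · exact Or.inr (Or.inr (Or.inl h))
      · exact Or.inr (Or.inr (Or.inr (Or.inl h)))
      · rw [h]
        exact hp
      · exact Or.inr (Or.inr (Or.inr (Or.inr h)))
    simp only [Finset.mem_insert, Finset.mem_singleton, forall_eq_or_imp, forall_eq] at hne
    obtain ⟨hyv, hya, hyb, hyc, hyz⟩ := hne
    -- With exactly six vertices the neighborhoods of `v`, `a` and `c` are full, which leaves `y`
    -- only `b` and `z`.
    have hsub : G.neighborFinset y ⊆ {b, z} := by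
      intro x hx
      rw [SimpleGraph.mem_neighborFinset] at hx
      rcases hall x with rfl | rfl | rfl | rfl | rfl | rfl
      · have := (hN y).1 hx.symm
        tauto
      · have := hNa y hx.symm
        tauto
      · simp
      · have := hz y hx.symm
        tauto
      · exact absurd rfl hx.ne
      · simp
    have h1 := (Finset.card_le_card hsub).trans Finset.card_le_two
    rw [G.card_neighborFinset_eq_degree] at h1
    have := hdeg y
    omega
  · have hb : G.degree c = 3 ∧ G.Adj c b := by
      rcases hcover b hvb.ne' with ⟨h, _⟩ | ⟨_, h⟩ | h
      · exact absurd h ha3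
      · exact absurd rfl h.ne
      · exact h
    have hc : G.degree b = 3 := by
      rcases hcover c hvc.ne' with ⟨h, _⟩ | ⟨h, _⟩ | ⟨_, h⟩
      · exact absurd h ha3
      · exact h
      · exact absurd rfl h.ne
    have h1 := hthree b v a c hc hva.ne hvc.ne hac' hvb.symm hab.symm hb.2.symm
    have h2 := hthree c v a b hb.1 hva.ne hvb.ne hab' hvc.symm hac.symm hb.2
    apply hsmall v a b c c
    intro y
    by_cases hyv : y = v
    · exact Or.inl hyv
    rcases hcover y hyv with ⟨h, _⟩ | ⟨_, h⟩ | ⟨_, h⟩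
    · exact absurd h ha3
    · have := h1 y h
      tauto
    · have := h2 y h
      tauto

/-- There is no graph on at least six vertices with all degrees at least three in which any two
vertices have a common neighbor of degree three. -/
theorem false_of_common_neighbor_three (hdeg : ∀ x, 3 ≤ G.degree x) (hn : 6 ≤ Fintype.card V)
    {v : V} (hv3 : G.degree v = 3)
    (hcom : ∀ y, y ≠ v → ∃ x, G.degree x = 3 ∧ G.Adj x v ∧ G.Adj x y) : False := by
  rw [← G.card_neighborFinset_eq_degree, Finset.card_eq_three] at hv3
  obtain ⟨a, b, c, hab, hac, hbc, hv⟩ := hv3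
  have hN : ∀ x, G.Adj v x ↔ x = a ∨ x = b ∨ x = c := fun x => by
    rw [← SimpleGraph.mem_neighborFinset, hv]
    simp
  have h : ∀ y, G.Adj v y → G.Adj a y ∨ G.Adj b y ∨ G.Adj c y := by
    intro y hy
    obtain ⟨x, -, hxv, hxy⟩ := hcom y hy.ne'
    rcases (hN x).1 hxv.symm with rfl | rfl | rfl <;> tauto
  have ha := h a ((hN a).2 (by simp))
  have hb := h b ((hN b).2 (by simp))
  have hc := h c ((hN c).2 (by simp))
  have hla : ¬ G.Adj a a := G.loopless.irrefl a
  have hlb : ¬ G.Adj b b := G.loopless.irrefl b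
  have hlc : ¬ G.Adj c c := G.loopless.irrefl c
  have h1 := G.adj_comm a b
  have h2 := G.adj_comm a c
  have h3 := G.adj_comm b c
  -- A graph on three vertices without isolated vertices contains a path through all of them; its
  -- middle vertex plays the role of `a` in the auxiliary lemma.
  have key : (G.Adj a b ∧ G.Adj a c) ∨ (G.Adj b a ∧ G.Adj b c) ∨ (G.Adj c a ∧ G.Adj c b) := by
    tauto
  rcases key with ⟨p, q⟩ | ⟨p, q⟩ | ⟨p, q⟩
  · exact false_of_common_neighbor_three_aux hdeg hn hv hab hac hbc hcom p q
  · exact false_of_common_neighbor_three_aux hdeg hn (hv.trans (Finset.insert_comm a b {c}))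
      hab.symm hbc hac hcom p q
  · refine false_of_common_neighbor_three_aux hdeg hn (a := c) (b := a) (c := b) (hv.trans ?_)
      hac.symm hbc.symm hab hcom p q
    ext x
    simp only [Finset.mem_insert, Finset.mem_singleton]
    tauto

/-- Since `n.choose k` is at least `(k + 4).choose 4`, the hypothesis yields `(k + 4) * (k + 3) ≤
24`, which fails from `k = 2` on. -/
theorem le_one_of_choose_le {n k : ℕ} (hn : k + 4 ≤ n) (h : n.choose k ≤ (k + 2) * (k + 1)) :
    k ≤ 1 := by
  have h1 : (k + 4).choose 4 ≤ (k + 2) * (k + 1) := by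
    rw [← Nat.choose_symm_add]
    exact (Nat.choose_le_choose k hn).trans h
  have h2 := Nat.descFactorial_eq_factorial_mul_choose (k + 4) 4
  have h3 : (k + 4).descFactorial 4 = (k + 4) * (k + 3) * ((k + 2) * (k + 1)) := by
    simp [Nat.descFactorial]
    ring
  have h4 : (4).factorial = 24 := rfl
  rw [h3, h4] at h2
  have h5 : (k + 4) * (k + 3) * ((k + 2) * (k + 1)) ≤ 24 * ((k + 2) * (k + 1)) := by omega
  have h6 := Nat.le_of_mul_le_mul_right h5 (by positivity)
  by_contra h7
  have : 6 * 5 ≤ (k + 4) * (k + 3) := Nat.mul_le_mul (by omega) (by omega)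
  omega

/-- If all sets of size `f` are skew forts and no smaller set is, where `2 ≤ f < n`, then the graph
is complete. -/
theorem eq_top_of_uniform {f : ℕ} (hf : 2 ≤ f) (hfn : f < Fintype.card V)
    (hall : ∀ S : Finset V, S.card = f → IsSkewFort G (S : Set V))
    (hmin : ∀ S : Finset V, IsSkewFort G (S : Set V) → f ≤ S.card) : G = ⊤ := by
  obtain ⟨t, ht⟩ : ∃ t, t + f = Fintype.card V + 2 := ⟨Fintype.card V + 2 - f, by omega⟩
  have hdeg : ∀ x, t ≤ G.degree x := by
    intro x
    have hx : ¬ IsSkewFort G ({x} : Set V) := fun h => by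
      have := hmin {x} (by simpa using h)
      simp at this
      omega
    obtain ⟨u, w, rfl, huw, -⟩ :=
      exists_unique_adj_of_not_isSkewFort (Set.singleton_nonempty x) hx
    have := le_degree_of_forall_isSkewFort (by omega) hall huw.symm
    omega
  have hcommon : ∀ T : Finset V, T.card + 1 = t →
      ∃ x, G.degree x = t ∧ ∀ y ∈ T, G.Adj x y := by
    intro T hT
    refine exists_common_neighbor hdeg (fun S hS hfort => ?_) T hT (by omega)
    have := hmin S hfort
    omega
  -- The choice of `T₀` is immaterial; it only produces a vertex `v` of degree exactly `t`.
  obtain ⟨T₀, -, hT₀⟩ := Finset.exists_subset_card_eq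
    (show t - 1 ≤ (Finset.univ : Finset V).card by rw [Finset.card_univ]; omega)
  obtain ⟨v, hv, -⟩ := hcommon T₀ (by omega)
  have htn : t < Fintype.card V := hv ▸ G.degree_lt_card_verts v
  obtain h1 | h2 | h3 : t + 1 = Fintype.card V ∨ t + 2 = Fintype.card V ∨
    t + 3 ≤ Fintype.card V := by omega
  · ext a b
    simp only [SimpleGraph.top_adj]
    refine ⟨fun h => h.ne, fun hab => ?_⟩
    have hsub : G.neighborFinset a ⊆ Finset.univ.erase a := fun y hy => by
      rw [SimpleGraph.mem_neighborFinset] at hy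
      simp [hy.ne']
    have heq := Finset.eq_of_subset_of_card_le hsub (by
      rw [Finset.card_erase_of_mem (Finset.mem_univ a), Finset.card_univ,
        G.card_neighborFinset_eq_degree]
      have := hdeg a
      omega)
    rw [← SimpleGraph.mem_neighborFinset, heq]
    simp [hab.symm]
  · exfalso
    obtain ⟨a⟩ : Nonempty V := ⟨v⟩
    have hb : 0 < (G.neighborFinset a).card := by
      rw [G.card_neighborFinset_eq_degree]
      have := hdeg a
      omega
    obtain ⟨b, hb⟩ := Finset.card_pos.1 hb
    rw [SimpleGraph.mem_neighborFinset] at hb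
    have hc : 0 < (G.neighborFinset a ∩ G.neighborFinset b).card := by
      have h1 := Finset.card_union_add_card_inter (G.neighborFinset a) (G.neighborFinset b)
      have h2 := Finset.card_le_univ (G.neighborFinset a ∪ G.neighborFinset b)
      rw [G.card_neighborFinset_eq_degree, G.card_neighborFinset_eq_degree] at h1
      have := hdeg a
      have := hdeg b
      omega
    obtain ⟨c, hc⟩ := Finset.card_pos.1 hc
    rw [Finset.mem_inter, SimpleGraph.mem_neighborFinset, SimpleGraph.mem_neighborFinset] at hc
    -- The complement of a triangle has `n - 3 = t - 1` elements. A vertex adjacent to all of them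
    -- lies in the triangle and so has degree `n - 1`, not `t`.
    have h3 : ({a, b, c} : Finset V).card = 3 :=
      Finset.card_eq_three.2 ⟨a, b, c, hb.ne, hc.1.ne, hc.2.ne, rfl⟩
    obtain ⟨x, hx, hxT⟩ := hcommon ({a, b, c} : Finset V)ᶜ (by
      rw [Finset.card_compl, h3]
      omega)
    have hxm : x ∈ ({a, b, c} : Finset V) := by
      by_contra h
      exact (hxT x (Finset.mem_compl.2 h)).ne rfl
    have htwo : ∀ y z, x ≠ y → x ≠ z → y ≠ z → G.Adj x y → G.Adj x z →
        ({x, y, z} : Finset V) = {a, b, c} → False := by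
      intro y z hxy hxz hyz h1 h2 heq
      have hsub : Finset.univ.erase x ⊆ G.neighborFinset x := by
        intro p hp
        rw [SimpleGraph.mem_neighborFinset]
        by_cases hpm : p ∈ ({x, y, z} : Finset V)
        · simp only [Finset.mem_insert, Finset.mem_singleton] at hpm
          rcases hpm with rfl | rfl | rfl
          · simp at hp
          · exact h1
          · exact h2
        · rw [heq] at hpm
          exact hxT p (Finset.mem_compl.2 hpm)
      have := Finset.card_le_card hsub
      rw [Finset.card_erase_of_mem (Finset.mem_univ x), Finset.card_univ,
        G.card_neighborFinset_eq_degree] at this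
      omega
    simp only [Finset.mem_insert, Finset.mem_singleton] at hxm
    rcases hxm with rfl | rfl | rfl
    · exact htwo b c hb.ne hc.1.ne hc.2.ne hb hc.1 rfl
    · exact htwo a c hb.ne' hc.2.ne hc.1.ne hb.symm hc.2 (Finset.insert_comm _ _ _)
    · refine htwo a b hc.1.ne' hc.2.ne' hb.ne hc.1.symm hc.2.symm ?_
      ext y
      simp only [Finset.mem_insert, Finset.mem_singleton]
      tauto
  · exfalso
    obtain ⟨k, rfl⟩ : ∃ k, t = k + 2 := ⟨t - 2, by omega⟩
    have hk1 : 1 ≤ k := by omega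
    -- Double count over the `k`-sets `T` avoiding `v`: a common neighbor of `T` and `v` is one of
    -- the `k + 2` neighbors of `v`, and each of degree `k + 2` accounts for at most `k + 1` sets
    -- `T`.
    have hchoose : (Fintype.card V - 1).choose k ≤ (k + 2) * (k + 1) := by
      have hsub : (Finset.univ.erase v).powersetCard k ⊆
          (G.neighborFinset v).biUnion fun x =>
            if G.degree x = k + 2 then ((G.neighborFinset x).erase v).powersetCard k else ∅ := by
        intro T hT
        rw [Finset.mem_powersetCard] at hT
        have hvT : v ∉ T := fun h => by simpa using hT.1 h
        obtain ⟨x, hx, hxT⟩ := hcommon (insert v T) (by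
          rw [Finset.card_insert_of_notMem hvT, hT.2])
        refine Finset.mem_biUnion.2 ⟨x, ?_, ?_⟩
        · rw [SimpleGraph.mem_neighborFinset]
          exact (hxT v (Finset.mem_insert_self _ _)).symm
        · rw [if_pos hx, Finset.mem_powersetCard]
          refine ⟨fun y hy => Finset.mem_erase.2 ⟨fun h => hvT (h ▸ hy), ?_⟩, hT.2⟩
          rw [SimpleGraph.mem_neighborFinset]
          exact hxT y (Finset.mem_insert_of_mem hy)
      have h1 := Finset.card_le_card hsub
      rw [Finset.card_powersetCard, Finset.card_erase_of_mem (Finset.mem_univ v),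
        Finset.card_univ] at h1
      refine h1.trans ?_
      have h2 := Finset.card_biUnion_le_card_mul (G.neighborFinset v) (fun x =>
            if G.degree x = k + 2 then ((G.neighborFinset x).erase v).powersetCard k else ∅)
            (k + 1) (by
        intro x hx
        rw [SimpleGraph.mem_neighborFinset] at hx
        split_ifs with hd
        · rw [Finset.card_powersetCard, Finset.card_erase_of_mem (by simpa using hx.symm),
            G.card_neighborFinset_eq_degree, hd]
          simp [Nat.choose_succ_self_right]
        · simp)
      rw [G.card_neighborFinset_eq_degree, hv] at h2
      exact h2
    have hk : k = 1 := le_antisymm (le_one_of_choose_le (by omega) hchoose) hk1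
    subst hk
    refine false_of_common_neighbor_three hdeg (by omega) hv fun y hy => ?_
    obtain ⟨x, hx, hxT⟩ := hcommon {v, y} (by rw [Finset.card_pair hy.symm])
    exact ⟨x, hx, hxT v (by simp), hxT y (by simp)⟩

end Uniform

/-! ### Threads: walks through vertices of degree two -/

section Threads

open SimpleGraph

variable {V : Type*} {G : SimpleGraph V} {H : Set V}

theorem eq_or_eq_of_ncard_neighborSet_eq_two {x y z w : V} (hx : (G.neighborSet x).ncard = 2)
    (hy : G.Adj x y) (hz : G.Adj x z) (hyz : y ≠ z) (hw : G.Adj x w) : w = y ∨ w = z := by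
  obtain ⟨a, b, -, hab⟩ := Set.ncard_eq_two.1 hx
  have h : ∀ v, G.Adj x v → v = a ∨ v = b := fun v hv => by
    have : v ∈ G.neighborSet x := hv
    rw [hab] at this
    simpa using this
  rcases h y hy with rfl | rfl <;> rcases h z hz with rfl | rfl <;> rcases h w hw with rfl | rfl <;>
    tauto

/-- A thread is a non-backtracking walk of positive length between vertices of `H` whose inner
vertices lie outside `H`. -/
structure IsThread (H : Set V) {s t : V} (p : G.Walk s t) : Prop where
  start_mem : s ∈ H
  end_mem : t ∈ H
  pos : 0 < p.length
  notMem : ∀ i, 0 < i → i < p.length → p.getVert i ∉ H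
  ne : ∀ i, i + 2 ≤ p.length → p.getVert i ≠ p.getVert (i + 2)

namespace IsThread

variable {s t : V} {p : G.Walk s t}

theorem adj_start (hp : IsThread H p) : G.Adj s (p.getVert 1) := by
  have := p.adj_getVert_succ hp.pos
  simpa using this

theorem adj_end (hp : IsThread H p) : G.Adj t (p.getVert (p.length - 1)) := by
  have h := p.adj_getVert_succ (i := p.length - 1) (by have := hp.pos; omega)
  rw [show p.length - 1 + 1 = p.length by have := hp.pos; omega, p.getVert_length] at h
  exact h.symm

theorem reverse (hp : IsThread H p) : IsThread H p.reverse where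
  start_mem := hp.end_mem
  end_mem := hp.start_mem
  pos := by simpa using hp.pos
  notMem i h1 h2 := by
    rw [Walk.length_reverse] at h2
    rw [Walk.getVert_reverse]
    exact hp.notMem _ (by omega) (by omega)
  ne i hi := by
    rw [Walk.length_reverse] at hi
    rw [Walk.getVert_reverse, Walk.getVert_reverse]
    have := hp.ne (p.length - (i + 2)) (by omega)
    rw [show p.length - (i + 2) + 2 = p.length - i by omega] at this
    exact this.symm

theorem getVert_one_reverse (p : G.Walk s t) :
    p.reverse.getVert 1 = p.getVert (p.length - 1) := Walk.getVert_reverse _ _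

theorem getVert_pred_reverse (hp : IsThread H p) :
    p.reverse.getVert (p.reverse.length - 1) = p.getVert 1 := by
  rw [Walk.getVert_reverse, Walk.length_reverse]
  congr 1
  have := hp.pos
  omega

theorem exists_inner (hp : IsThread H p) {x : V} (hx : x ∈ p.support) (hxH : x ∉ H) :
    ∃ i, 0 < i ∧ i < p.length ∧ p.getVert i = x := by
  obtain ⟨i, rfl, hi⟩ := Walk.mem_support_iff_exists_getVert.1 hx
  refine ⟨i, Nat.pos_of_ne_zero ?_, lt_of_le_of_ne hi ?_, rfl⟩
  · rintro rfl
    exact hxH (by simpa using hp.start_mem)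
  · rintro rfl
    exact hxH (by simpa using hp.end_mem)

/-- Functions that agree on the neighbors of every vertex outside `H` alternate along threads. -/
theorem alternate {α : Type*} {f : V → α} (hp : IsThread H p)
    (hf : ∀ x, x ∉ H → ∀ y z, G.Adj x y → G.Adj x z → f y = f z) (i : ℕ) :
    (2 * i ≤ p.length → f (p.getVert (2 * i)) = f s) ∧
      (2 * i + 1 ≤ p.length → f (p.getVert (2 * i + 1)) = f (p.getVert 1)) := by
  have hstep : ∀ j, j + 2 ≤ p.length → f (p.getVert (j + 2)) = f (p.getVert j) := fun j hj =>
    hf _ (hp.notMem (j + 1) (by omega) (by omega)) _ _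
      (p.adj_getVert_succ (i := j + 1) (by omega)) (p.adj_getVert_succ (i := j) (by omega)).symm
  induction i with
  | zero => simp
  | succ i ih =>
    refine ⟨fun h => ?_, fun h => ?_⟩
    · exact (hstep (2 * i) h).trans (ih.1 (by omega))
    · exact (hstep (2 * i + 1) h).trans (ih.2 (by omega))

/-- The functions of interest are membership in a skew fort and the link class; both agree on the
neighbors of a degree-two vertex. The parity of the length decides whether the value at `t`
reappears at `s` or at the neighbor of `s`. -/
theorem apply_end_of_odd {α : Type*} {f : V → α} (hp : IsThread H p) (ho : Odd p.length)
    (hf : ∀ x, x ∉ H → ∀ y z, G.Adj x y → G.Adj x z → f y = f z) :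
    f t = f (p.getVert 1) := by
  obtain ⟨k, hk⟩ := ho
  have := (hp.alternate hf k).2 hk.ge
  rwa [← hk, p.getVert_length] at this

theorem apply_end_of_even {α : Type*} {f : V → α} (hp : IsThread H p) (he : Even p.length)
    (hf : ∀ x, x ∉ H → ∀ y z, G.Adj x y → G.Adj x z → f y = f z) : f t = f s := by
  obtain ⟨k, hk⟩ := he
  rw [← two_mul] at hk
  have := (hp.alternate hf k).1 hk.ge
  rwa [← hk, p.getVert_length] at this

theorem apply_pred_of_odd {α : Type*} {f : V → α} (hp : IsThread H p) (ho : Odd p.length)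
    (hf : ∀ x, x ∉ H → ∀ y z, G.Adj x y → G.Adj x z → f y = f z) :
    f (p.getVert (p.length - 1)) = f s := by
  obtain ⟨k, hk⟩ := ho
  have := (hp.alternate hf k).1 (by omega)
  rwa [show 2 * k = p.length - 1 by omega] at this

theorem apply_pred_of_even {α : Type*} {f : V → α} (hp : IsThread H p) (he : Even p.length)
    (hf : ∀ x, x ∉ H → ∀ y z, G.Adj x y → G.Adj x z → f y = f z) :
    f (p.getVert (p.length - 1)) = f (p.getVert 1) := by
  obtain ⟨k, hk⟩ := he
  have hpos := hp.pos
  have := (hp.alternate hf (k - 1)).2 (by omega)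
  rwa [show 2 * (k - 1) + 1 = p.length - 1 by omega] at this

theorem eq_of_adj_inner (hH : ∀ x, x ∉ H → (G.neighborSet x).ncard = 2)
    (hp : IsThread H p) {i : ℕ} (hi : i + 2 ≤ p.length) {y : V}
    (hy : G.Adj (p.getVert (i + 1)) y) : y = p.getVert i ∨ y = p.getVert (i + 2) :=
  eq_or_eq_of_ncard_neighborSet_eq_two (hH _ (hp.notMem (i + 1) (by omega) (by omega)))
    (p.adj_getVert_succ (i := i) (by omega)).symm (p.adj_getVert_succ (i := i + 1) (by omega))
    (hp.ne i hi) hy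

/-- The neighbors of an inner vertex of a thread lie on it, and so do the edges to them. -/
theorem mem_edges_of_adj (hH : ∀ x, x ∉ H → (G.neighborSet x).ncard = 2)
    (hp : IsThread H p) {x y : V} (hx : x ∈ p.support) (hxH : x ∉ H)
    (hxy : G.Adj x y) : s(x, y) ∈ p.edges := by
  obtain ⟨i, h0, hi, rfl⟩ := hp.exists_inner hx hxH
  obtain ⟨j, rfl⟩ : ∃ j, i = j + 1 := ⟨i - 1, by omega⟩
  rw [Walk.mk_mem_edges_iff_exists]
  rcases hp.eq_of_adj_inner hH (by omega) hxy with rfl | rfl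
  · exact ⟨j, by omega, Sym2.eq_swap⟩
  · exact ⟨j + 1, hi, rfl⟩

/-- Threads with the same initial edge agree as long as both are defined. -/
theorem getVert_eq (hH : ∀ x, x ∉ H → (G.neighborSet x).ncard = 2)
    (hp : IsThread H p) {t' : V} {q : G.Walk s t'} (hq : IsThread H q)
    (h1 : p.getVert 1 = q.getVert 1) (i : ℕ) (hip : i ≤ p.length) (hiq : i ≤ q.length) :
    p.getVert i = q.getVert i := by
  induction i using Nat.strong_induction_on with
  | _ i ih =>
    match i with
    | 0 => simp
    | 1 => exact h1
    | j + 2 =>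
      have e1 := ih (j + 1) (by omega) (by omega) (by omega)
      have e0 := ih j (by omega) (by omega) (by omega)
      have h := p.adj_getVert_succ (i := j + 1) (by omega)
      rw [e1] at h
      rcases hq.eq_of_adj_inner hH hiq h with h | h
      · exact absurd (e0.trans h.symm) (hp.ne j hip)
      · exact h

theorem length_eq (hH : ∀ x, x ∉ H → (G.neighborSet x).ncard = 2)
    (hp : IsThread H p) {t' : V} {q : G.Walk s t'} (hq : IsThread H q)
    (h1 : p.getVert 1 = q.getVert 1) : p.length = q.length := by
  rcases lt_trichotomy p.length q.length with h | h | h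
  · exfalso
    have := hp.getVert_eq hH hq h1 p.length le_rfl h.le
    rw [p.getVert_length] at this
    exact hq.notMem _ hp.pos h (this ▸ hp.end_mem)
  · exact h
  · exfalso
    have := hp.getVert_eq hH hq h1 q.length h.le le_rfl
    rw [q.getVert_length] at this
    exact hp.notMem _ hq.pos h (this.symm ▸ hq.end_mem)

theorem end_eq (hH : ∀ x, x ∉ H → (G.neighborSet x).ncard = 2)
    (hp : IsThread H p) {t' : V} {q : G.Walk s t'} (hq : IsThread H q)
    (h1 : p.getVert 1 = q.getVert 1) : t = t' := by
  have hl := hp.length_eq hH hq h1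
  have := hp.getVert_eq hH hq h1 p.length le_rfl hl.le
  rwa [p.getVert_length, hl, q.getVert_length] at this

theorem pred_eq (hH : ∀ x, x ∉ H → (G.neighborSet x).ncard = 2)
    (hp : IsThread H p) {t' : V} {q : G.Walk s t'} (hq : IsThread H q)
    (h1 : p.getVert 1 = q.getVert 1) :
    p.getVert (p.length - 1) = q.getVert (q.length - 1) := by
  have hl := hp.length_eq hH hq h1
  rw [← hl]
  exact hp.getVert_eq hH hq h1 _ (by omega) (by omega)

theorem eq_of_getVert_one (hH : ∀ x, x ∉ H → (G.neighborSet x).ncard = 2)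
    (hp : IsThread H p) {q : G.Walk s t} (hq : IsThread H q)
    (h1 : p.getVert 1 = q.getVert 1) : p = q :=
  Walk.ext_getVert_le_length (hp.length_eq hH hq h1) fun i hi =>
    hp.getVert_eq hH hq h1 i hi (hi.trans (hp.length_eq hH hq h1).le)

/-- Threads with the same final edge have the same initial edge. -/
theorem getVert_one_eq (hH : ∀ x, x ∉ H → (G.neighborSet x).ncard = 2)
    (hp : IsThread H p) {s' : V} {q : G.Walk s' t} (hq : IsThread H q)
    (h1 : p.getVert (p.length - 1) = q.getVert (q.length - 1)) :
    s = s' ∧ p.getVert 1 = q.getVert 1 := by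
  have h : p.reverse.getVert 1 = q.reverse.getVert 1 := by
    rw [getVert_one_reverse, getVert_one_reverse, h1]
  refine ⟨hp.reverse.end_eq hH hq.reverse h, ?_⟩
  have := hp.reverse.pred_eq hH hq.reverse h
  rwa [hp.getVert_pred_reverse, hq.getVert_pred_reverse] at this

/-- If an inner vertex of a thread lies in a set closed under passing from vertices outside `H` to
their neighbors, then the whole thread lies in it. -/
theorem support_subset (hp : IsThread H p) {C : Set V}
    (hC : ∀ x ∈ C, x ∉ H → ∀ y, G.Adj x y → y ∈ C) {x : V} (hx : x ∈ p.support) (hxH : x ∉ H)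
    (hxC : x ∈ C) : ∀ y ∈ p.support, y ∈ C := by
  obtain ⟨i, h0, hi, rfl⟩ := hp.exists_inner hx hxH
  have hup : ∀ j, i + j ≤ p.length → p.getVert (i + j) ∈ C := by
    intro j
    induction j with
    | zero => exact fun _ => hxC
    | succ j ih =>
      intro hj
      exact hC _ (ih (by omega)) (hp.notMem _ (by omega) (by omega)) _
        (p.adj_getVert_succ (by omega))
  have hdown : ∀ j, j ≤ i → p.getVert (i - j) ∈ C := by
    intro j
    induction j with
    | zero => exact fun _ => hxC
    | succ j ih =>
      intro hj
      have h := p.adj_getVert_succ (i := i - (j + 1)) (by omega)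
      rw [show i - (j + 1) + 1 = i - j by omega] at h
      exact hC _ (ih (by omega)) (hp.notMem _ (by omega) (by omega)) _ h.symm
  intro y hy
  obtain ⟨k, rfl, hk⟩ := Walk.mem_support_iff_exists_getVert.1 hy
  rcases le_total i k with h | h
  · have := hup (k - i) (by omega)
    rwa [show i + (k - i) = k by omega] at this
  · have := hdown (i - k) (by omega)
    rwa [show i - (i - k) = k by omega] at this

theorem isPath_of_tail (hp : IsThread H p) (ht : p.tail.IsPath) (hst : s ≠ t) : p.IsPath := by
  have hnil : ¬ p.Nil := by
    rw [← Walk.length_eq_zero_iff.not]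
    · exact hp.pos.ne'
  rw [← p.cons_tail_eq hnil, Walk.cons_isPath_iff]
  refine ⟨ht, fun hs => ?_⟩
  obtain ⟨i, hi, hil⟩ := Walk.mem_support_iff_exists_getVert.1 hs
  have hlen := Walk.length_tail_add_one hnil
  rw [Walk.getVert_tail] at hi
  rcases (show i + 1 ≤ p.length by omega).lt_or_eq with h | h
  · exact hp.notMem _ (by omega) h (hi.symm ▸ hp.start_mem)
  · rw [h, p.getVert_length] at hi
    exact hst hi.symm

theorem isCycle_of_tail {p : G.Walk s s} (hp : IsThread H p) (ht : p.tail.IsPath) :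
    p.IsCycle := by
  rw [Walk.isCycle_iff_isPath_tail_and_le_length]
  refine ⟨ht, ?_⟩
  by_contra hlt
  have hpos := hp.pos
  obtain h | h : p.length = 1 ∨ p.length = 2 := by omega
  · have := hp.adj_start
    rw [← h, p.getVert_length] at this
    exact this.ne rfl
  · have := hp.ne 0 h.ge
    rw [zero_add, ← h, p.getVert_zero, p.getVert_length] at this
    exact this rfl

end IsThread

/-- A path with inner vertices outside `H` and distinct ends in `H` is a thread. -/
theorem SimpleGraph.Walk.IsPath.isThread {s t : V} {p : G.Walk s t} (hp : p.IsPath) (hst : s ≠ t)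
    (hs : s ∈ H) (ht : t ∈ H) (hin : ∀ x ∈ p.support, x ≠ s → x ≠ t → x ∉ H) :
    IsThread H p where
  start_mem := hs
  end_mem := ht
  pos := Nat.pos_of_ne_zero fun h => hst (Walk.eq_of_length_eq_zero h)
  notMem i h0 hi := by
    refine hin _ (p.getVert_mem_support i) (fun h => ?_) (fun h => ?_)
    · rw [hp.getVert_eq_start_iff hi.le] at h
      omega
    · rw [hp.getVert_eq_end_iff hi.le] at h
      omega
  ne i hi h := by
    have := hp.getVert_injOn (show i ≤ p.length by omega) hi h
    omega

/-- A cycle with inner vertices outside `H` through a vertex in `H` is a thread. -/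
theorem SimpleGraph.Walk.IsCycle.isThread {s : V} {p : G.Walk s s} (hp : p.IsCycle)
    (hs : s ∈ H) (hin : ∀ x ∈ p.support, x ≠ s → x ∉ H) : IsThread H p where
  start_mem := hs
  end_mem := hs
  pos := by have := hp.three_le_length; omega
  notMem i h0 hi := by
    refine hin _ (p.getVert_mem_support i) (fun h => ?_)
    rw [hp.getVert_endpoint_iff hi.le] at h
    omega
  ne i hi h := by
    have := hp.getVert_sub_one_ne_getVert_add_one (i := i + 1) (by omega)
    exact this h

section Existence

variable [Fintype V]

/-- The path `q` outside `H` is extended by the neighbor of its end that does not lead back, until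
`H` is reached. The number `n` bounds the remaining extensions, as a path is shorter than the number
of vertices. -/
theorem exists_isThread_aux (hH : ∀ x, x ∉ H → (G.neighborSet x).ncard = 2)
    {s x : V} (hs : s ∈ H) (hsx : G.Adj s x) (n : ℕ) :
    ∀ (y : V) (q : G.Walk x y), q.IsPath → (∀ z ∈ q.support, z ∉ H) →
      Fintype.card V ≤ q.length + n →
      ∃ (t : V) (p : G.Walk s t), IsThread H p ∧ p.getVert 1 = x ∧ p.tail.IsPath := by
  induction n with
  | zero =>
    intro y q hq _ hc
    have := hq.length_lt
    omega
  | succ n ih =>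
    intro y q hq hqH hc
    have hget : ∀ i, q.getVert i ∈ q.support := fun i => q.getVert_mem_support i
    -- With `s` prepended, `w.getVert i` is the predecessor of `q.getVert i`, also for `i = 0`.
    set w := Walk.cons hsx q with hw
    have hwl : w.length = q.length + 1 := Walk.length_cons _ _
    have hwg : ∀ i, w.getVert (i + 1) = q.getVert i := fun i => Walk.getVert_cons_succ _ _
    have hy := hH y (hqH y q.end_mem_support)
    have hprev : G.Adj (w.getVert q.length) y := by
      have := w.adj_getVert_succ (i := q.length) (by omega)
      rwa [hwg, q.getVert_length] at this
    obtain ⟨z, hyz, hzprev⟩ : ∃ z, G.Adj y z ∧ z ≠ w.getVert q.length := by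
      obtain ⟨a, b, hab, hN⟩ := Set.ncard_eq_two.1 hy
      have ha : G.Adj y a := (hN.symm.subset (by simp) : a ∈ G.neighborSet y)
      have hb : G.Adj y b := (hN.symm.subset (by simp) : b ∈ G.neighborSet y)
      by_cases h : a = w.getVert q.length
      · exact ⟨b, hb, fun h' => hab (h.trans h'.symm)⟩
      · exact ⟨a, ha, h⟩
    by_cases hzH : z ∈ H
    · have hzq : z ∉ q.support := fun h => hqH z h hzH
      have hpath : (q.concat hyz).IsPath := hq.concat hzq hyz
      refine ⟨z, Walk.cons hsx (q.concat hyz), ?_, by simp, by simpa using hpath⟩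
      have hl : (Walk.cons hsx (q.concat hyz)).length = q.length + 2 := by simp
      have hg : ∀ i ≤ q.length, (Walk.cons hsx (q.concat hyz)).getVert (i + 1) = q.getVert i := by
        intro i hi
        rw [Walk.getVert_cons_succ, Walk.concat_eq_append, Walk.getVert_append]
        rcases hi.lt_or_eq with h | rfl
        · rw [if_pos h]
        · simp
      have hlast : (Walk.cons hsx (q.concat hyz)).getVert (q.length + 2) = z := by
        rw [← hl, Walk.getVert_length]
      refine ⟨hs, hzH, by omega, ?_, ?_⟩
      · intro i h0 hi
        obtain ⟨j, rfl⟩ : ∃ j, i = j + 1 := ⟨i - 1, by omega⟩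
        rw [hg j (by omega)]
        exact hqH _ (hget j)
      · intro i hi
        rw [hl] at hi
        rcases (show i ≤ q.length by omega).lt_or_eq with h | rfl
        · rw [hg (i + 1) h]
          rcases i with _ | j
          · rw [Walk.getVert_zero]
            exact fun h => hqH _ (hget 1) (h ▸ hs)
          · rw [hg j (by omega)]
            intro h'
            have := hq.getVert_injOn (show j ≤ q.length by omega) (show j + 2 ≤ q.length by omega) h'
            omega
        · rw [hlast]
          intro h
          apply hzprev
          rw [← h]
          generalize hk : q.length = k
          rcases k with _ | j
          · simp
          · rw [hg j (by omega), hwg]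
    by_cases hzq : z ∈ q.support
    -- A revisited vertex `q.getVert i` would have three distinct neighbors: its predecessor, its
    -- successor and `y`.
    · exfalso
      obtain ⟨i, rfl, hi⟩ := Walk.mem_support_iff_exists_getVert.1 hzq
      have hadj1 : G.Adj (q.getVert i) (w.getVert i) := by
        have := w.adj_getVert_succ (i := i) (by omega)
        rw [hwg] at this
        exact this.symm
      have hne1 : i ≠ q.length := by
        rintro rfl
        rw [q.getVert_length] at hyz
        exact hyz.ne rfl
      have hadj2 := q.adj_getVert_succ (i := i) (by omega)
      have hne2 : i + 1 ≠ q.length := by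
        intro h
        apply hzprev
        rw [← h, hwg]
      have hinj : ∀ a b, a ≤ q.length → b ≤ q.length → q.getVert a = q.getVert b → a = b :=
        fun a b ha hb h => hq.getVert_injOn ha hb h
      have hd : w.getVert i ≠ q.getVert (i + 1) := by
        rcases i with _ | j
        · rw [Walk.getVert_zero]
          exact fun h => hqH _ (hget 1) (h ▸ hs)
        · rw [hwg]
          intro h
          have := hinj _ _ (by omega) (by omega) h
          omega
      rcases eq_or_eq_of_ncard_neighborSet_eq_two (hH _ hzH) hadj1 hadj2 hd hyz.symm with h | h
      · rcases i with _ | j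
        · rw [Walk.getVert_zero] at h
          exact hqH _ q.end_mem_support (h ▸ hs)
        · rw [hwg] at h
          have := hinj _ _ le_rfl (by omega) (q.getVert_length.trans h)
          omega
      · have := hinj _ _ le_rfl (by omega) (q.getVert_length.trans h)
        omega
    · refine ih z (q.concat hyz) (hq.concat hzq hyz) ?_ ?_
      · intro v hv
        rw [Walk.support_concat] at hv
        rcases List.mem_append.1 hv with h | h
        · exact hqH v h
        · rw [List.mem_singleton.1 h]
          exact hzH
      · rw [Walk.length_concat]
        omega

/-- Every edge at a vertex of `H` is the initial edge of a thread. -/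
theorem exists_isThread (hH : ∀ x, x ∉ H → (G.neighborSet x).ncard = 2)
    {s x : V} (hs : s ∈ H) (hsx : G.Adj s x) :
    ∃ (t : V) (p : G.Walk s t), IsThread H p ∧ p.getVert 1 = x ∧ p.tail.IsPath := by
  by_cases hx : x ∈ H
  · refine ⟨x, Walk.cons hsx Walk.nil, ⟨hs, hx, by simp, ?_, ?_⟩, by simp, by simp⟩
    · intro i h0 hi
      simp at hi
      omega
    · intro i hi
      simp at hi
  · exact exists_isThread_aux hH hs hsx (Fintype.card V) x Walk.nil (by simp) (by simpa using hx)
      (by simp)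

/-- The thread constructed from the same initial edge has this property, and a thread is determined
by its initial edge. -/
theorem IsThread.isPath_tail (hH : ∀ x, x ∉ H → (G.neighborSet x).ncard = 2)
    {s t : V} {p : G.Walk s t} (hp : IsThread H p) : p.tail.IsPath := by
  obtain ⟨t', q, hq, h1, hqt⟩ := exists_isThread hH hp.start_mem hp.adj_start
  obtain rfl := hp.end_eq hH hq h1.symm
  rwa [hp.eq_of_getVert_one hH hq h1.symm]

theorem IsThread.isPath (hH : ∀ x, x ∉ H → (G.neighborSet x).ncard = 2)
    {s t : V} {p : G.Walk s t} (hp : IsThread H p) (hst : s ≠ t) :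
    p.IsPath := hp.isPath_of_tail (hp.isPath_tail hH) hst

theorem IsThread.isCycle (hH : ∀ x, x ∉ H → (G.neighborSet x).ncard = 2)
    {s : V} {p : G.Walk s s} (hp : IsThread H p) : p.IsCycle :=
  hp.isCycle_of_tail (hp.isPath_tail hH)

/-- If only the empty set and the whole vertex set are closed under adjacency, every edge lies on
a thread. -/
theorem exists_isThread_of_adj (hH : ∀ x, x ∉ H → (G.neighborSet x).ncard = 2)
    (hne : H.Nonempty)
    (hconn : ∀ T : Set V, T.Nonempty → (∀ x ∈ T, ∀ y, G.Adj x y → y ∈ T) → T = Set.univ)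
    {x y : V} (hxy : G.Adj x y) :
    ∃ (s t : V) (p : G.Walk s t), IsThread H p ∧ s(x, y) ∈ p.edges := by
  have hstart : ∀ a b, a ∈ H → G.Adj a b →
      ∃ (s t : V) (p : G.Walk s t), IsThread H p ∧ s(a, b) ∈ p.edges := by
    intro a b ha hab
    obtain ⟨t, p, hp, h1, -⟩ := exists_isThread hH ha hab
    refine ⟨a, t, p, hp, ?_⟩
    rw [Walk.mk_mem_edges_iff_exists]
    exact ⟨0, hp.pos, by simp [h1]⟩
  have hcov : {v : V | v ∈ H ∨ ∃ (s t : V) (p : G.Walk s t), IsThread H p ∧ v ∈ p.support} =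
      Set.univ := by
    apply hconn
    · obtain ⟨h, hh⟩ := hne
      exact ⟨h, Or.inl hh⟩
    · rintro a ha b hab
      right
      by_cases haH : a ∈ H
      · obtain ⟨s, t, p, hp, he⟩ := hstart a b haH hab
        exact ⟨s, t, p, hp, p.snd_mem_support_of_mem_edges he⟩
      · obtain ⟨s, t, p, hp, hap⟩ := ha.resolve_left haH
        exact ⟨s, t, p, hp, p.snd_mem_support_of_mem_edges (hp.mem_edges_of_adj hH hap haH hab)⟩
  by_cases hxH : x ∈ H
  · exact hstart x y hxH hxy
  · have hx : x ∈ Set.univ := Set.mem_univ x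
    rw [← hcov] at hx
    obtain ⟨s, t, p, hp, hxp⟩ := hx.resolve_left hxH
    exact ⟨s, t, p, hp, hp.mem_edges_of_adj hH hxp hxH hxy⟩

end Existence

/-- The vertices at odd positions of a closed thread of even length form a skew fort. -/
theorem IsThread.isSkewFort_of_even (hH : ∀ x, x ∉ H → (G.neighborSet x).ncard = 2)
    {s : V} {p : G.Walk s s} (hp : IsThread H p)
    (hc : p.IsCycle) (he : Even p.length) :
    IsSkewFort G {x | ∃ i, 2 * i + 1 < p.length ∧ p.getVert (2 * i + 1) = x} := by
  have hlen := hc.three_le_length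
  obtain ⟨k, hk⟩ := he
  have hinj : ∀ a b, a ≤ p.length - 1 → b ≤ p.length - 1 → p.getVert a = p.getVert b → a = b :=
    fun a b ha hb h => hc.getVert_injOn' ha hb h
  refine ⟨⟨p.getVert 1, 0, by omega, rfl⟩, ?_⟩
  rintro u w ⟨i, hi, rfl⟩ huw
  have hends : ∀ j, 2 * j + 1 < p.length → u = s → ∃ w' ∈ {x | ∃ i, 2 * i + 1 < p.length ∧
      p.getVert (2 * i + 1) = x}, w' ≠ p.getVert (2 * j + 1) ∧ G.Adj u w' := by
    rintro j hj rfl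
    by_cases hj0 : j = 0
    · subst hj0
      refine ⟨p.getVert (p.length - 1), ⟨k - 1, by omega, by congr 1; omega⟩, fun h => ?_,
        hp.adj_end⟩
      have := hinj _ _ le_rfl (by omega) h
      omega
    · refine ⟨p.getVert 1, ⟨0, by omega, rfl⟩, fun h => ?_, hp.adj_start⟩
      have := hinj _ _ (by omega) (by omega) h
      omega
  rcases hp.eq_of_adj_inner hH (i := 2 * i) (by omega) huw.symm with rfl | rfl
  · rcases i with _ | j
    · exact hends 0 hi (by simp)
    · refine ⟨p.getVert (2 * j + 1), ⟨j, by omega, rfl⟩, fun h => ?_, ?_⟩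
      · have := hinj _ _ (by omega) (by omega) h
        omega
      · exact (p.adj_getVert_succ (i := 2 * j + 1) (by omega)).symm
  · rcases (show 2 * i + 2 ≤ p.length by omega).lt_or_eq with h | h
    · refine ⟨p.getVert (2 * (i + 1) + 1), ⟨i + 1, by omega, rfl⟩, fun h' => ?_, ?_⟩
      · have := hinj _ _ (by omega) (by omega) h'
        omega
      · exact p.adj_getVert_succ (i := 2 * i + 2) h
    · exact hends i hi (by rw [h, p.getVert_length])

/-- For even length the vertices at odd positions would be a skew fort that omits `s`. -/
theorem IsThread.odd_of_isCycle (hH : ∀ x, x ∉ H → (G.neighborSet x).ncard = 2)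
    {s : V} {p : G.Walk s s} (hp : IsThread H p) (hc : p.IsCycle)
    (hmin : ∀ F, IsSkewFort G F → F = Set.univ) : Odd p.length := by
  rw [← Nat.not_even_iff_odd]
  intro he
  have h := hmin _ (hp.isSkewFort_of_even hH hc he)
  have hs : s ∈ Set.univ := Set.mem_univ s
  rw [← h] at hs
  obtain ⟨i, hi, his⟩ := hs
  rw [hc.getVert_endpoint_iff hi.le] at his
  omega

end Threads

/-! ### Bouquets and dipoles have only one skew fort -/

section Converse

open SimpleGraph

variable {V : Type*} {G : SimpleGraph V} {H : Set V}

theorem isSkewFort_univ [Nonempty V] (h : ∀ u, ∃ a b, a ≠ b ∧ G.Adj u a ∧ G.Adj u b) :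
    IsSkewFort G Set.univ := by
  refine ⟨Set.univ_nonempty, fun u w _ _ => ?_⟩
  obtain ⟨a, b, hab, ha, hb⟩ := h u
  by_cases haw : a = w
  · exact ⟨b, Set.mem_univ b, fun h => hab (haw.trans h.symm), hb⟩
  · exact ⟨a, Set.mem_univ a, haw, ha⟩

theorem exists_two_adj_of_ncard {x : V} (hx : (G.neighborSet x).ncard = 2) :
    ∃ a b, a ≠ b ∧ G.Adj x a ∧ G.Adj x b := by
  obtain ⟨a, b, hab, hN⟩ := Set.ncard_eq_two.1 hx
  exact ⟨a, b, hab, (hN.symm.subset (by simp) : a ∈ G.neighborSet x),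
    (hN.symm.subset (by simp) : b ∈ G.neighborSet x)⟩

/-- A skew fort contains both or neither of the neighbors of a vertex of degree two. -/
theorem IsSkewFort.mem_eq_mem {F : Set V} (hF : IsSkewFort G F) {x y z : V}
    (hx : (G.neighborSet x).ncard = 2) (hy : G.Adj x y) (hz : G.Adj x z) :
    (y ∈ F) = (z ∈ F) := by
  have key : ∀ y z, G.Adj x y → G.Adj x z → y ∈ F → z ∈ F := by
    intro y z hy hz hyF
    by_cases hyz : y = z
    · exact hyz ▸ hyF
    obtain ⟨w, hw, hne, ha⟩ := hF.2 x y hyF hy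
    rcases eq_or_eq_of_ncard_neighborSet_eq_two hx hy hz hyz ha with h | h
    · exact absurd h hne
    · exact h ▸ hw
  exact propext ⟨key y z hy hz, key z y hz hy⟩

namespace IsThread

variable {s t : V} {p : G.Walk s t}

/-- The only edges of a thread at vertices of `H` are its initial and final edges. -/
theorem eq_of_mem_edges (hp : IsThread H p) {h y : V} (hh : h ∈ H) (he : s(h, y) ∈ p.edges) :
    (h = s ∧ y = p.getVert 1) ∨ (h = t ∧ y = p.getVert (p.length - 1)) := by
  obtain ⟨i, hi, he⟩ := (Walk.mk_mem_edges_iff_exists p).1 he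
  rcases Sym2.eq_iff.1 he with ⟨rfl, rfl⟩ | ⟨rfl, rfl⟩
  · left
    rcases Nat.eq_zero_or_pos i with rfl | h0
    · simp
    · exact absurd hh (hp.notMem i h0 hi)
  · right
    rcases (show i + 1 ≤ p.length from hi).lt_or_eq with h | h
    · exact absurd hh (hp.notMem _ (by omega) h)
    · rw [← h, Nat.add_sub_cancel, h, p.getVert_length]
      exact ⟨rfl, rfl⟩

theorem apply_eq_of_odd {α : Type*} {f : V → α} (hp : IsThread H p) (ho : Odd p.length)
    (hf : ∀ x, x ∉ H → ∀ y z, G.Adj x y → G.Adj x z → f y = f z) {x : V} (hx : x ∈ p.support) :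
    f x = f s ∨ f x = f t := by
  obtain ⟨i, rfl, hi⟩ := Walk.mem_support_iff_exists_getVert.1 hx
  obtain ⟨k, rfl | rfl⟩ := Nat.even_or_odd' i
  · exact Or.inl ((hp.alternate hf k).1 hi)
  · exact Or.inr (((hp.alternate hf k).2 hi).trans (hp.apply_end_of_odd ho hf).symm)

end IsThread

/-- The two neighbors of a vertex on a cycle. -/
theorem SimpleGraph.Walk.IsCycle.ncard_neighborSet {c : V} {p : G.Walk c c} (hp : p.IsCycle)
    {x : V} (hx : x ∈ p.support) (hxc : x ≠ c) (hN : ∀ y, G.Adj x y → s(x, y) ∈ p.edges) :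
    (G.neighborSet x).ncard = 2 := by
  obtain ⟨i, rfl, hi⟩ := Walk.mem_support_iff_exists_getVert.1 hx
  have hlen := hp.three_le_length
  have hi0 : i ≠ 0 := by
    rintro rfl
    simp at hxc
  have hil : i ≠ p.length := by
    rintro rfl
    simp at hxc
  obtain ⟨j, rfl⟩ : ∃ j, i = j + 1 := ⟨i - 1, by omega⟩
  rw [Set.ncard_eq_two]
  refine ⟨p.getVert j, p.getVert (j + 2),
    hp.getVert_sub_one_ne_getVert_add_one (i := j + 1) (by omega), ?_⟩
  ext y
  simp only [mem_neighborSet, Set.mem_insert_iff, Set.mem_singleton_iff]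
  constructor
  · intro hy
    obtain ⟨k, hk, he⟩ := (Walk.mk_mem_edges_iff_exists p).1 (hN y hy)
    rcases Sym2.eq_iff.1 he with ⟨h1, rfl⟩ | ⟨rfl, h1⟩
    · have : k = j + 1 := hp.getVert_injOn' (show k ≤ p.length - 1 by omega)
        (show j + 1 ≤ p.length - 1 by omega) h1
      exact Or.inr (by rw [this])
    · have : k + 1 = j + 1 := hp.getVert_injOn (show 1 ≤ k + 1 ∧ k + 1 ≤ p.length by omega)
        (show 1 ≤ j + 1 ∧ j + 1 ≤ p.length by omega) h1
      exact Or.inl (by rw [Nat.succ_injective this])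
  · rintro (rfl | rfl)
    · exact (p.adj_getVert_succ (by omega)).symm
    · exact p.adj_getVert_succ (i := j + 1) (by omega)

theorem SimpleGraph.Walk.IsCycle.exists_two_adj {c : V} {p : G.Walk c c} (hp : p.IsCycle) :
    ∃ a b, a ≠ b ∧ G.Adj c a ∧ G.Adj c b := by
  have hlen := hp.three_le_length
  refine ⟨p.snd, p.penultimate, hp.snd_ne_penultimate, p.adj_snd hp.not_nil,
    (p.adj_penultimate hp.not_nil).symm⟩

/-- In a bouquet of odd cycles the vertex set is the only skew fort. -/
theorem IsOddCycleBouquet.isSkewFort_iff (h : IsOddCycleBouquet G) (F : Set V) :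
    IsSkewFort G F ↔ F = Set.univ := by
  obtain ⟨c, C, ⟨p₀, hp₀⟩, hcyc, hdisj, hcov, hedge⟩ := h
  have hdeg : ∀ x, x ∉ ({c} : Set V) → (G.neighborSet x).ncard = 2 := by
    intro x hx
    obtain ⟨p, hp, hxp⟩ := hcov x
    refine (hcyc p hp).1.ncard_neighborSet hxp hx fun y hy => ?_
    obtain ⟨q, hq, he⟩ := hedge s(x, y) hy
    have hpq : p = q := by
      by_contra hne
      exact hx ((hdisj p hp q hq hne).subset ⟨hxp, q.fst_mem_support_of_mem_edges he⟩)
    rwa [hpq]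
  have hthread : ∀ p ∈ C, IsThread {c} p := fun p hp =>
    (hcyc p hp).1.isThread (Set.mem_singleton c) fun x _ hxc => hxc
  constructor
  · intro hF
    have hsame : ∀ x, (x ∈ F) = (c ∈ F) := by
      intro x
      obtain ⟨p, hp, hxp⟩ := hcov x
      have := (hthread p hp).apply_eq_of_odd (f := fun x => x ∈ F) (hcyc p hp).2
        (fun x hx y z hy hz => hF.mem_eq_mem (hdeg x hx) hy hz) hxp
      tauto
    obtain ⟨x, hx⟩ := hF.1
    rw [hsame] at hx
    refine Set.eq_univ_of_forall fun y => ?_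
    rwa [hsame]
  · rintro rfl
    have : Nonempty V := ⟨c⟩
    refine isSkewFort_univ fun u => ?_
    by_cases hu : u ∈ ({c} : Set V)
    · rw [Set.mem_singleton_iff] at hu
      subst hu
      exact (hcyc p₀ hp₀).1.exists_two_adj
    · exact exists_two_adj_of_ncard (hdeg u hu)

/-- A predicate on `{0, …, 2m+1}` that propagates down the odd numbers to `0` and up the even
numbers to `2m+1` holds everywhere as soon as it holds somewhere. -/
theorem forall_of_dipole_propagation {b : ℕ → Prop} {m : ℕ} (h1 : b 1 → b 0)
    (h2 : ∀ k < m, b (2 * k + 3) → b (2 * k + 1)) (h3 : ∀ k < m, b (2 * k) → b (2 * k + 2))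
    (h4 : b (2 * m) → b (2 * m + 1)) {j : ℕ} (hj : j < 2 * m + 2) (hbj : b j) :
    ∀ i < 2 * m + 2, b i := by
  -- The implications form a directed cycle: `0` to `2` up to `2 * m`, then to `2 * m + 1`, down the
  -- odd numbers to `1` and back to `0`.
  have hodd : ∀ d k, k + d ≤ m → b (2 * (k + d) + 1) → b (2 * k + 1) := by
    intro d
    induction d with
    | zero => exact fun k _ h => h
    | succ d ih =>
      intro k hk h
      exact ih k (by omega) (h2 (k + d) (by omega) h)
  have heven : ∀ d k, k + d ≤ m → b (2 * k) → b (2 * (k + d)) := by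
    intro d
    induction d with
    | zero => exact fun k _ h => h
    | succ d ih =>
      intro k hk h
      exact h3 (k + d) (by omega) (ih k (by omega) h)
  have hlast : b (2 * m + 1) := by
    obtain ⟨k, rfl | rfl⟩ := Nat.even_or_odd' j
    · have := heven (m - k) k (by omega) hbj
      rw [show k + (m - k) = m by omega] at this
      exact h4 this
    · have h0 := h1 (hodd k 0 (by omega) (by rwa [zero_add]))
      have := heven m 0 (by omega) h0
      rw [zero_add] at this
      exact h4 this
  have hoddall : ∀ k ≤ m, b (2 * k + 1) := fun k hk =>
    hodd (m - k) k (by omega) (by rwa [show k + (m - k) = m by omega])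
  intro i hi
  obtain ⟨k, rfl | rfl⟩ := Nat.even_or_odd' i
  · have := heven k 0 (by omega) (h1 (hoddall 0 (by omega)))
    rwa [zero_add] at this
  · exact hoddall k (by omega)

/-- In a doubly extended bouquet-dipole the vertex set is the only skew fort. -/
theorem IsDoublyExtendedBouquetDipole.isSkewFort_iff (h : IsDoublyExtendedBouquetDipole G)
    (F : Set V) : IsSkewFort G F ↔ F = Set.univ := by
  obtain ⟨m, s, C, D, P, hs, ⟨c₀, hc₀⟩, ⟨d₀, hd₀⟩, hC, hD, hP, heven, hodd, hcov, hedge⟩ := h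
  have hsne : ∀ a b : Fin (2 * m + 1 + 1), a ≠ b → s a ≠ s b := fun a b hab h => hab (hs h)
  have hdeg : ∀ x, x ∉ Set.range s → (G.neighborSet x).ncard = 2 := by
    intro x hx
    have hne : ∀ i, x ≠ s i := fun i h => hx ⟨i, h.symm⟩
    rcases hcov x with ⟨c, hc, hxc⟩ | ⟨d, hd, hxd⟩ | ⟨j, p, hp, hxp⟩
    · exact ((hC c hc).2.2 x hxc (hne _)).2
    · exact ((hD d hd).2.2 x hxd (hne _)).2
    · exact ((hP j p hp).2.2 x hxp (hne _) (hne _)).2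
  have hCt : ∀ c ∈ C, IsThread (Set.range s) c := fun c hc =>
    (hC c hc).1.isThread ⟨_, rfl⟩ fun x hx hne => ((hC c hc).2.2 x hx hne).1
  have hDt : ∀ d ∈ D, IsThread (Set.range s) d := fun d hd =>
    (hD d hd).1.isThread ⟨_, rfl⟩ fun x hx hne => ((hD d hd).2.2 x hx hne).1
  have hPt : ∀ j, ∀ p ∈ P j, IsThread (Set.range s) p := fun j p hp =>
    (hP j p hp).1.isThread (hsne _ _ (Fin.castSucc_lt_succ).ne) ⟨_, rfl⟩ ⟨_, rfl⟩
      fun x hx h1 h2 => ((hP j p hp).2.2 x hx h1 h2).1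
  have hPne : ∀ j, (P j).Nonempty := by
    intro j
    rcases Nat.even_or_odd (j : ℕ) with hj | hj
    · obtain ⟨p, hp⟩ := heven j hj
      exact ⟨p, hp ▸ Set.mem_singleton p⟩
    · exact (hodd j hj).nonempty
  constructor
  · intro hF
    have hf : ∀ x, x ∉ Set.range s → ∀ y z, G.Adj x y → G.Adj x z → (y ∈ F) = (z ∈ F) :=
      fun x hx y z hy hz => hF.mem_eq_mem (hdeg x hx) hy hz
    -- All threads being odd, a neighbor of `s i` belongs to `F` exactly when the far end of the
    -- thread through it does.
    have hnb : ∀ (i : Fin (2 * m + 1 + 1)) (y : V), G.Adj (s i) y → y ∈ F →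
        (i = 0 ∧ s i ∈ F) ∨ (i = Fin.last (2 * m + 1) ∧ s i ∈ F) ∨
        (∃ j, ∃ p ∈ P j, i = j.castSucc ∧ y = p.getVert 1 ∧ s j.succ ∈ F) ∨
        (∃ j, ∃ p ∈ P j, i = j.succ ∧ y = p.getVert (p.length - 1) ∧ s j.castSucc ∈ F) := by
      intro i y hy hyF
      rcases hedge s(s i, y) hy with ⟨c, hc, he⟩ | ⟨d, hd, he⟩ | ⟨j, p, hp, he⟩
      · left
        have ht := hCt c hc
        have h1 : (s 0 ∈ F) = (c.getVert 1 ∈ F) :=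
          ht.apply_end_of_odd (f := fun x => x ∈ F) (hC c hc).2.1 hf
        have h2 : (c.getVert (c.length - 1) ∈ F) = (s 0 ∈ F) :=
          ht.apply_pred_of_odd (f := fun x => x ∈ F) (hC c hc).2.1 hf
        rcases ht.eq_of_mem_edges ⟨i, rfl⟩ he with ⟨hi, rfl⟩ | ⟨hi, rfl⟩
        · exact ⟨hs hi, by rwa [hi, h1]⟩
        · exact ⟨hs hi, by rwa [hi, ← h2]⟩
      · right; left
        have ht := hDt d hd
        have h1 : (s (Fin.last (2 * m + 1)) ∈ F) = (d.getVert 1 ∈ F) :=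
          ht.apply_end_of_odd (f := fun x => x ∈ F) (hD d hd).2.1 hf
        have h2 : (d.getVert (d.length - 1) ∈ F) = (s (Fin.last (2 * m + 1)) ∈ F) :=
          ht.apply_pred_of_odd (f := fun x => x ∈ F) (hD d hd).2.1 hf
        rcases ht.eq_of_mem_edges ⟨i, rfl⟩ he with ⟨hi, rfl⟩ | ⟨hi, rfl⟩
        · exact ⟨hs hi, by rwa [hi, h1]⟩
        · exact ⟨hs hi, by rwa [hi, ← h2]⟩
      · right; right
        have ht := hPt j p hp
        have h1 : (s j.succ ∈ F) = (p.getVert 1 ∈ F) :=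
          ht.apply_end_of_odd (f := fun x => x ∈ F) (hP j p hp).2.1 hf
        have h2 : (p.getVert (p.length - 1) ∈ F) = (s j.castSucc ∈ F) :=
          ht.apply_pred_of_odd (f := fun x => x ∈ F) (hP j p hp).2.1 hf
        rcases ht.eq_of_mem_edges ⟨i, rfl⟩ he with ⟨hi, rfl⟩ | ⟨hi, rfl⟩
        · exact Or.inl ⟨j, p, hp, hs hi, rfl, by rwa [h1]⟩
        · exact Or.inr ⟨j, p, hp, hs hi, rfl, by rwa [← h2]⟩
    -- For even `j` a single thread runs from `s j` to `s (j + 1)`. If its far end is in `F`, then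
    -- `s j` needs a second neighbor in `F`, which lies on a cycle at `s 0` or on a thread from `s
    -- (j - 1)`. The next claim is the mirror image, at `s (j + 1)`.
    have hE : ∀ j : Fin (2 * m + 1), Even (j : ℕ) → s j.succ ∈ F →
        (j.castSucc = 0 ∧ s 0 ∈ F) ∨ ∃ k : Fin (2 * m + 1), j.castSucc = k.succ ∧
          s k.castSucc ∈ F := by
      intro j hj hjF
      obtain ⟨p, hp⟩ := heven j hj
      have hpP : p ∈ P j := hp ▸ Set.mem_singleton p
      have ht := hPt j p hpP
      have h1 : (s j.succ ∈ F) = (p.getVert 1 ∈ F) :=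
        ht.apply_end_of_odd (f := fun x => x ∈ F) (hP j p hpP).2.1 hf
      obtain ⟨y, hyF, hne, hy⟩ := hF.2 _ (p.getVert 1) (h1 ▸ hjF) ht.adj_start
      rcases hnb _ y hy hyF with ⟨h0, hF0⟩ | ⟨hl, _⟩ | ⟨k, q, hq, hk, hyq, -⟩ | ⟨k, q, hq, hk, _, hF'⟩
      · exact Or.inl ⟨h0, h0 ▸ hF0⟩
      · exact absurd hl (Fin.castSucc_lt_last j).ne
      · obtain rfl := Fin.castSucc_injective _ hk
        rw [hp, Set.mem_singleton_iff] at hq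
        exact absurd (hq ▸ hyq) hne
      · exact Or.inr ⟨k, hk, hF'⟩
    have hO : ∀ j : Fin (2 * m + 1), Even (j : ℕ) → s j.castSucc ∈ F →
        (j.succ = Fin.last (2 * m + 1) ∧ s (Fin.last (2 * m + 1)) ∈ F) ∨
          ∃ k : Fin (2 * m + 1), j.succ = k.castSucc ∧ s k.succ ∈ F := by
      intro j hj hjF
      obtain ⟨p, hp⟩ := heven j hj
      have hpP : p ∈ P j := hp ▸ Set.mem_singleton p
      have ht := hPt j p hpP
      have h1 : (p.getVert (p.length - 1) ∈ F) = (s j.castSucc ∈ F) :=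
        ht.apply_pred_of_odd (f := fun x => x ∈ F) (hP j p hpP).2.1 hf
      obtain ⟨y, hyF, hne, hy⟩ := hF.2 _ (p.getVert (p.length - 1)) (h1.symm ▸ hjF) ht.adj_end
      rcases hnb _ y hy hyF with ⟨h0, _⟩ | ⟨hl, hF0⟩ | ⟨k, q, hq, hk, _, hF'⟩ | ⟨k, q, hq, hk, hyq, -⟩
      · exact absurd h0 (Fin.succ_ne_zero j)
      · exact Or.inl ⟨hl, hl ▸ hF0⟩
      · exact Or.inr ⟨k, hk, hF'⟩
      · obtain rfl := Fin.succ_injective _ hk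
        rw [hp, Set.mem_singleton_iff] at hq
        exact absurd (hq ▸ hyq) hne
    have hall : ∀ i, s i ∈ F → ∀ j, s j ∈ F := by
      intro i hi j
      have := forall_of_dipole_propagation (m := m)
        (b := fun n => ∃ h : n < 2 * m + 1 + 1, s ⟨n, h⟩ ∈ F) ?_ ?_ ?_ ?_ (j := i) i.2 ⟨i.2, hi⟩
        j j.2
      · exact this.2
      · rintro ⟨h, h1⟩
        rcases hE ⟨0, by omega⟩ (by simp) h1 with ⟨_, h0⟩ | ⟨k, hk, _⟩
        · exact ⟨by omega, h0⟩
        · exact absurd hk.symm (Fin.succ_ne_zero k)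
      · rintro k hk ⟨h, h1⟩
        rcases hE ⟨2 * k + 2, by omega⟩ (by simp [parity_simps]) h1 with ⟨h0, _⟩ | ⟨l, hl, h2⟩
        · simp [Fin.ext_iff] at h0
        · have : l.castSucc = ⟨2 * k + 1, by omega⟩ := by
            simp [Fin.ext_iff] at hl ⊢
            omega
          exact ⟨by omega, this ▸ h2⟩
      · rintro k hk ⟨h, h1⟩
        rcases hO ⟨2 * k, by omega⟩ (by simp) h1 with ⟨h0, _⟩ | ⟨l, hl, h2⟩
        · have : 2 * k + 1 = 2 * m + 1 := congrArg Fin.val h0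
          omega
        · have : l.succ = ⟨2 * k + 2, by omega⟩ := by
            simp [Fin.ext_iff] at hl ⊢
            omega
          exact ⟨by omega, this ▸ h2⟩
      · rintro ⟨h, h1⟩
        rcases hO ⟨2 * m, by omega⟩ (by simp) h1 with ⟨h0, h2⟩ | ⟨l, hl, h2⟩
        · exact ⟨by omega, h2⟩
        · have := l.2
          simp [Fin.ext_iff] at hl
          omega
    have hend : ∀ x, ∃ i, (x ∈ F) = (s i ∈ F) := by
      intro x
      rcases hcov x with ⟨c, hc, hx⟩ | ⟨d, hd, hx⟩ | ⟨j, p, hp, hx⟩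
      · rcases (hCt c hc).apply_eq_of_odd (f := fun x => x ∈ F) (hC c hc).2.1 hf hx with h | h <;>
          exact ⟨_, h⟩
      · rcases (hDt d hd).apply_eq_of_odd (f := fun x => x ∈ F) (hD d hd).2.1 hf hx with h | h <;>
          exact ⟨_, h⟩
      · rcases (hPt j p hp).apply_eq_of_odd (f := fun x => x ∈ F) (hP j p hp).2.1 hf hx with h | h <;>
          exact ⟨_, h⟩
    obtain ⟨x, hx⟩ := hF.1
    obtain ⟨i, hi⟩ := hend x
    rw [hi] at hx
    refine Set.eq_univ_of_forall fun y => ?_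
    obtain ⟨j, hj⟩ := hend y
    rw [hj]
    exact hall i hx j
  · rintro rfl
    have : Nonempty V := ⟨s 0⟩
    refine isSkewFort_univ fun u => ?_
    by_cases hu : u ∈ Set.range s
    swap
    · exact exists_two_adj_of_ncard (hdeg u hu)
    obtain ⟨i, rfl⟩ := hu
    by_cases hi0 : i = 0
    · rw [hi0]
      exact (hC c₀ hc₀).1.exists_two_adj
    by_cases hil : i = Fin.last (2 * m + 1)
    · rw [hil]
      exact (hD d₀ hd₀).1.exists_two_adj
    obtain ⟨j, hj⟩ := Fin.exists_succ_eq.2 hi0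
    obtain ⟨k, hk⟩ := Fin.exists_castSucc_eq.2 hil
    obtain ⟨p, hp⟩ := hPne j
    obtain ⟨q, hq⟩ := hPne k
    have hpt := hPt j p hp
    have hqt := hPt k q hq
    have ha1 := hpt.adj_end
    have ha2 := hqt.adj_start
    -- These two neighbors differ because threads leaving by the same edge have the same end, while
    -- the two threads lead to different `s` values.
    refine ⟨p.getVert (p.length - 1), q.getVert 1, fun h => ?_, hj ▸ ha1, hk ▸ ha2⟩
    have hjk : j.succ = k.castSucc := hj.trans hk.symm
    have hends : ∀ (a b : V) (r : G.Walk a (s j.castSucc)) (r' : G.Walk b (s k.succ)), a = b →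
        IsThread (Set.range s) r → IsThread (Set.range s) r' → r.getVert 1 = r'.getVert 1 →
        s j.castSucc = s k.succ := by
      rintro a b r r' rfl h1 h2 h3
      exact h1.end_eq hdeg h2 h3
    have := hs (hends _ _ p.reverse q (congrArg s hjk) hpt.reverse hqt (by
      rw [IsThread.getVert_one_reverse, h]))
    simp [Fin.ext_iff] at this hjk
    omega

end Converse

/-! ### Two involutions with transitive product -/

section Dihedral

/-- Two involutions `ρ`, `θ` of a finite set, `θ` without fixed points, whose product acts
transitively: the set can be listed so that `ρ` fixes the first and the last element and `θ` and
`ρ` alternately lead from each element to the next. -/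
theorem exists_alternating_enumeration {H : Type*} [Finite H] [Nonempty H] (ρ θ : H → H)
    (hρ : Function.Involutive ρ) (hθ : Function.Involutive θ) (hfix : ∀ h, θ h ≠ h)
    (htrans : ∀ T : Set H, T.Nonempty → (∀ h ∈ T, ρ (θ h) ∈ T) → T = Set.univ) :
    ∃ (m : ℕ) (s : Fin (2 * m + 1 + 1) → H), Function.Bijective s ∧ ρ (s 0) = s 0 ∧
      ρ (s (Fin.last (2 * m + 1))) = s (Fin.last (2 * m + 1)) ∧
      (∀ j : Fin (2 * m + 1), Even (j : ℕ) → θ (s j.castSucc) = s j.succ) ∧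
      ∀ j : Fin (2 * m + 1), Odd (j : ℕ) → ρ (s j.castSucc) = s j.succ := by
  let R : Equiv.Perm H := hρ.toPerm
  let S : Equiv.Perm H := R * hθ.toPerm
  have hS : ∀ h, S h = ρ (θ h) := fun h => rfl
  have hSinv : ∀ h, S⁻¹ h = θ (ρ h) := by
    intro h
    rw [Equiv.Perm.inv_eq_iff_eq, hS, hθ, hρ]
  have hRS : R * S * R⁻¹ = S⁻¹ := by
    ext h
    rw [hSinv]
    change ρ (ρ (θ (ρ h))) = _
    rw [hρ]
  have hRSz : ∀ (j : ℤ) h, ρ ((S ^ j) h) = (S ^ (-j)) (ρ h) := by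
    intro j h
    have : R * S ^ j * R⁻¹ = S ^ (-j) := by
      rw [← conj_zpow, hRS, inv_zpow, zpow_neg]
    rw [← this]
    change ρ ((S ^ j) h) = ρ ((S ^ j) (ρ (ρ h)))
    rw [hρ]
  obtain ⟨h₀⟩ := ‹Nonempty H›
  have hadd : ∀ (i j : ℤ) h, (S ^ i) ((S ^ j) h) = (S ^ (i + j)) h := fun i j h => by
    rw [zpow_add, Equiv.Perm.mul_apply]
  have hsurj : ∀ x y : H, ∃ j : ℤ, (S ^ j) x = y := by
    intro x y
    have := htrans {z | ∃ j : ℤ, (S ^ j) x = z} ⟨x, 0, by simp⟩ (by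
      rintro z ⟨j, rfl⟩
      refine ⟨1 + j, ?_⟩
      rw [← hadd, zpow_one, hS])
    exact this.symm.subset (Set.mem_univ y)
  have hρS : ∀ h, ρ (S h) = θ h := fun h => by rw [hS, hρ]
  -- Write `ρ h₀` as `(S ^ c) h₀`. For `c = 2 * k` the point `(S ^ k) h₀` is fixed by `ρ`; for `c =
  -- 2 * k + 1` it would be fixed by `θ`.
  obtain ⟨b, hb⟩ : ∃ b, ρ b = b := by
    obtain ⟨c, hc⟩ := hsurj h₀ (ρ h₀)
    obtain ⟨k, rfl | rfl⟩ := Int.even_or_odd' c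
    · refine ⟨(S ^ k) h₀, ?_⟩
      rw [hRSz, ← hc, hadd]
      congr 2
      ring
    · exfalso
      apply hfix ((S ^ k) h₀)
      rw [← hρS]
      have : S ((S ^ k) h₀) = (S ^ (1 + k)) h₀ := by rw [← hadd, zpow_one]
      rw [this, hRSz, ← hc, hadd]
      congr 2
      ring
  have hρe : ∀ j : ℤ, ρ ((S ^ j) b) = (S ^ (-j)) b := fun j => by rw [hRSz, hb]
  have hθe : ∀ j : ℤ, θ ((S ^ j) b) = (S ^ (-(j + 1))) b := fun j => by
    rw [← hρS, ← hρe]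
    congr 1
    rw [add_comm, ← hadd, zpow_one]
  set p := Function.minimalPeriod (fun x => S • x) b with hp
  have hper : ∀ i j : ℤ, (S ^ i) b = (S ^ j) b ↔ (p : ℤ) ∣ i - j := by
    intro i j
    rw [hp, ← MulAction.zpow_smul_eq_iff_minimalPeriod_dvd, Equiv.Perm.smul_def, sub_eq_add_neg,
      add_comm, ← hadd, zpow_neg, Equiv.Perm.inv_eq_iff_eq]
  -- `Function.minimalPeriod` is zero for a non-periodic point, which finiteness rules out.
  have hp0 : p ≠ 0 := by
    intro h0
    have hinj : Function.Injective fun i : ℤ => (S ^ i) b := by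
      intro i j hij
      have := (hper i j).1 hij
      rw [h0, Nat.cast_zero, zero_dvd_iff] at this
      omega
    exact not_injective_infinite_finite _ hinj
  -- On exponents modulo `p`, `ρ` acts as `j ↦ -j` and `θ` as `j ↦ -(j + 1)`. For `p = 2 * q + 1`
  -- the latter would fix `q`.
  obtain ⟨m, hm⟩ : ∃ m, p = 2 * m + 2 := by
    obtain ⟨q, hq | hq⟩ := Nat.even_or_odd' p
    · exact ⟨q - 1, by omega⟩
    · exfalso
      apply hfix ((S ^ (q : ℤ)) b)
      rw [hθe, hper, hq]
      exact ⟨-1, by push_cast; ring⟩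
  -- Applying `θ` and `ρ` in turn from `0` gives the exponents `0, -1, 1, -2, 2, …`. The last one,
  -- `-(m + 1)`, is its own negative modulo `p`.
  let g : ℕ → ℤ := fun j => if j % 2 = 0 then (j / 2 : ℕ) else -((j + 1) / 2 : ℕ)
  have hg0 : ∀ k, g (2 * k) = k := fun k => by
    have h1 : 2 * k % 2 = 0 := by omega
    have h2 : 2 * k / 2 = k := by omega
    simp only [g, h1, h2, if_true]
  have hg1 : ∀ k, g (2 * k + 1) = -(k + 1 : ℕ) := fun k => by
    have h1 : (2 * k + 1) % 2 ≠ 0 := by omega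
    have h2 : (2 * k + 1 + 1) / 2 = k + 1 := by omega
    simp only [g, h1, h2, if_false]
  refine ⟨m, fun j => (S ^ g j) b, ⟨?_, ?_⟩, ?_, ?_, ?_, ?_⟩
  · intro i j hij
    have hd := (hper _ _).1 hij
    have hi := i.2
    have hj := j.2
    have habs : |g i - g j| < (p : ℤ) := by
      rw [abs_lt, hm]
      obtain ⟨k, hk | hk⟩ := Nat.even_or_odd' (i : ℕ) <;>
        obtain ⟨l, hl | hl⟩ := Nat.even_or_odd' (j : ℕ) <;> rw [hk, hl] <;>
        simp only [hg0, hg1] <;> push_cast <;> constructor <;> omega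
    have h0 := Int.eq_zero_of_abs_lt_dvd hd habs
    apply Fin.ext
    obtain ⟨k, hk | hk⟩ := Nat.even_or_odd' (i : ℕ) <;>
      obtain ⟨l, hl | hl⟩ := Nat.even_or_odd' (j : ℕ) <;> rw [hk, hl] at h0 ⊢ <;>
      simp only [hg0, hg1] at h0 <;> push_cast at h0 <;> omega
  · intro x
    obtain ⟨j, rfl⟩ := hsurj b x
    have h1 := Int.emod_nonneg j (b := (p : ℤ)) (by omega)
    have h2 := Int.emod_lt_of_pos j (b := (p : ℤ)) (by omega)
    have h3 := Int.mul_ediv_add_emod j p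
    by_cases hle : j % (p : ℤ) ≤ m
    · refine ⟨⟨2 * (j % (p : ℤ)).toNat, by omega⟩, ?_⟩
      change (S ^ g _) b = _
      rw [hg0, hper]
      exact ⟨-(j / p), by rw [Int.toNat_of_nonneg h1]; linarith⟩
    · refine ⟨⟨2 * (p - 1 - (j % (p : ℤ))).toNat + 1, by omega⟩, ?_⟩
      change (S ^ g _) b = _
      rw [hg1, hper]
      refine ⟨-(j / p) - 1, ?_⟩
      push_cast
      rw [Int.toNat_of_nonneg (by omega)]
      linarith
  · change ρ ((S ^ g (2 * 0)) b) = (S ^ g (2 * 0)) b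
    rw [hρe, hg0]
    simp
  · change ρ ((S ^ g (2 * m + 1)) b) = (S ^ g (2 * m + 1)) b
    rw [hρe, hg1, hper, hm]
    exact ⟨1, by push_cast; ring⟩
  · rintro ⟨j, hj⟩ he
    obtain ⟨k, hk⟩ := he
    change j = k + k at hk
    obtain rfl : j = 2 * k := by omega
    change θ ((S ^ g (2 * k)) b) = (S ^ g (2 * k + 1)) b
    rw [hθe, hg0, hg1]
    norm_num
  · rintro ⟨j, hj⟩ ho
    obtain ⟨k, hk⟩ := ho
    change j = 2 * k + 1 at hk
    subst hk
    change ρ ((S ^ g (2 * k + 1)) b) = (S ^ g (2 * (k + 1))) b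
    rw [hρe, hg0, hg1]
    norm_num

end Dihedral

/-! ### Only one skew fort: connectedness and the bouquet case -/

section MinimalFort

open SimpleGraph

variable {V : Type*} {G : SimpleGraph V}

/-- In a graph on at least two vertices whose only skew fort is the vertex set, all degrees are at
least two. -/
theorem exists_two_adj_of_minimal [Nontrivial V] (hV : IsSkewFort G Set.univ)
    (hmin : ∀ F, IsSkewFort G F → F = Set.univ) (x : V) :
    ∃ a b, a ≠ b ∧ G.Adj x a ∧ G.Adj x b := by
  have : ∃ a, G.Adj x a := by
    by_contra hcon
    push Not at hcon
    have hx : IsSkewFort G {x} := by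
      refine ⟨Set.singleton_nonempty x, ?_⟩
      rintro u w rfl huw
      exact absurd huw.symm (hcon u)
    obtain ⟨y, hy⟩ := exists_ne x
    exact hy ((hmin _ hx).symm.subset (Set.mem_univ y))
  obtain ⟨a, ha⟩ := this
  obtain ⟨b, -, hne, hb⟩ := hV.2 x a (Set.mem_univ a) ha
  exact ⟨a, b, hne.symm, ha, hb⟩

/-- A graph on at least two vertices whose only skew fort is the vertex set is connected. -/
theorem eq_univ_of_closed_of_minimal [Nontrivial V] (hV : IsSkewFort G Set.univ)
    (hmin : ∀ F, IsSkewFort G F → F = Set.univ) {T : Set V} (hne : T.Nonempty)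
    (hT : ∀ x ∈ T, ∀ y, G.Adj x y → y ∈ T) : T = Set.univ := by
  refine hmin T ⟨hne, fun u w hw huw => ?_⟩
  have hu := hT w hw u huw.symm
  obtain ⟨a, b, hab, ha, hb⟩ := exists_two_adj_of_minimal hV hmin u
  by_cases haw : a = w
  · exact ⟨b, hT u hu b hb, fun h => hab (haw.trans h.symm), hb⟩
  · exact ⟨a, hT u hu a ha, haw, ha⟩

/-- If the vertices outside `{c}` have degree two, the graph is a bouquet of odd cycles. -/
theorem isOddCycleBouquet_of_minimal [Fintype V] [Nontrivial V] (hV : IsSkewFort G Set.univ)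
    (hmin : ∀ F, IsSkewFort G F → F = Set.univ) (c : V)
    (hH : ∀ x, x ∉ ({c} : Set V) → (G.neighborSet x).ncard = 2) : IsOddCycleBouquet G := by
  classical
  have hcov : ∀ x y, G.Adj x y → ∃ p : G.Walk c c, IsThread {c} p ∧ s(x, y) ∈ p.edges := by
    intro x y hxy
    obtain ⟨s, t, p, hp, he⟩ := exists_isThread_of_adj hH (Set.singleton_nonempty c)
      (fun T hne hT => eq_univ_of_closed_of_minimal hV hmin hne hT) hxy
    obtain rfl : s = c := hp.start_mem
    obtain rfl : t = s := hp.end_mem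
    exact ⟨p, hp, he⟩
  have hsub : ∀ p q : G.Walk c c, IsThread {c} p → IsThread {c} q → ∀ x ∈ p.support,
      x ∈ q.support → x ≠ c → ∀ y ∈ p.support, y ∈ q.support := by
    intro p q hp hq x hxp hxq hxc
    refine hp.support_subset (C := {y | y ∈ q.support}) (fun z hz hzc y hzy => ?_) hxp hxc hxq
    exact q.snd_mem_support_of_mem_edges (hq.mem_edges_of_adj hH hz hzc hzy)
  let thr := {p : G.Walk c c // IsThread {c} p}
  let S : thr → Finset V := fun p => p.1.support.toFinset
  -- A cycle can be traversed in both directions, which gives different walks with the same support,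
  -- whereas distinct members of a bouquet may share only `c`. So one thread is chosen for each
  -- support.
  let rep : thr → thr := fun p => Classical.choose (⟨p, rfl⟩ : ∃ q : thr, S q = S p)
  have hrep : ∀ p, S (rep p) = S p := fun p =>
    Classical.choose_spec (⟨p, rfl⟩ : ∃ q : thr, S q = S p)
  have hrep' : ∀ p q, S p = S q → rep p = rep q := by
    intro p q h
    simp only [rep, h]
  have hmem : ∀ (p : thr) x, x ∈ p.1.support ↔ x ∈ (rep p).1.support := by
    intro p x
    have := hrep p
    rw [← List.mem_toFinset (l := p.1.support), ← List.mem_toFinset (l := (rep p).1.support)]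
    exact (Finset.ext_iff.1 this x).symm
  have hedge : ∀ x y, G.Adj x y → ∃ p : thr, s(x, y) ∈ (rep p).1.edges := by
    intro x y hxy
    obtain ⟨p, hp, he⟩ := hcov x y hxy
    refine ⟨⟨p, hp⟩, ?_⟩
    by_cases hxc : x = c
    · have hyc : y ≠ c := fun h => hxy.ne (hxc.trans h.symm)
      rw [Sym2.eq_swap]
      exact (rep ⟨p, hp⟩).2.mem_edges_of_adj hH
        ((hmem ⟨p, hp⟩ y).1 (p.snd_mem_support_of_mem_edges he)) hyc hxy.symm
    · exact (rep ⟨p, hp⟩).2.mem_edges_of_adj hH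
        ((hmem ⟨p, hp⟩ x).1 (p.fst_mem_support_of_mem_edges he)) hxc hxy
  refine ⟨c, {q | ∃ p, (rep p).1 = q}, ?_, ?_, ?_, ?_, ?_⟩
  · obtain ⟨a, b, -, ha, -⟩ := exists_two_adj_of_minimal hV hmin c
    obtain ⟨p, -⟩ := hedge c a ha
    exact ⟨_, p, rfl⟩
  · rintro _ ⟨p, rfl⟩
    have hc := (rep p).2.isCycle hH
    exact ⟨hc, (rep p).2.odd_of_isCycle hH hc hmin⟩
  · rintro _ ⟨p, rfl⟩ _ ⟨q, rfl⟩ hne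
    ext x
    simp only [Set.mem_ofPred_eq, Set.mem_singleton_iff]
    refine ⟨fun ⟨h1, h2⟩ => ?_, ?_⟩
    · by_contra hxc
      apply hne
      rw [hrep' p q]
      rw [← hrep p, ← hrep q]
      ext y
      simp only [S, List.mem_toFinset]
      exact ⟨hsub _ _ (rep p).2 (rep q).2 x h1 h2 hxc y,
        hsub _ _ (rep q).2 (rep p).2 x h2 h1 hxc y⟩
    · rintro rfl
      exact ⟨Walk.start_mem_support _, Walk.start_mem_support _⟩
  · intro x
    obtain ⟨a, b, -, ha, -⟩ := exists_two_adj_of_minimal hV hmin x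
    obtain ⟨p, hp⟩ := hedge x a ha
    exact ⟨_, ⟨p, rfl⟩, Walk.fst_mem_support_of_mem_edges _ hp⟩
  · intro e he
    induction e using Sym2.ind with
    | _ x y =>
      obtain ⟨p, hp⟩ := hedge x y he
      exact ⟨_, ⟨p, rfl⟩, hp⟩

end MinimalFort

/-! ### Link classes and thin edges -/

section LinkClasses

open SimpleGraph

/-- A graph with at most `k` edges on `n` vertices has at least `n - k` connected components. -/
theorem card_le_card_connectedComponent_add {V ι : Type*} [Fintype V] [Fintype ι]
    {L : SimpleGraph V} (a b : ι → V)
    (hL : ∀ y z, L.Adj y z → ∃ i, (a i = y ∧ b i = z) ∨ (a i = z ∧ b i = y)) :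
    Nat.card V ≤ Nat.card L.ConnectedComponent + Nat.card ι := by
  classical
  -- Rank and nullity: the kernel of `Φ` consists of functions constant on components, and its
  -- codimension is at most the number of edges listed.
  let Φ : (V → ℚ) →ₗ[ℚ] (ι → ℚ) := LinearMap.funLeft ℚ ℚ a - LinearMap.funLeft ℚ ℚ b
  let Ψ : (L.ConnectedComponent → ℚ) →ₗ[ℚ] (V → ℚ) :=
    LinearMap.funLeft ℚ ℚ L.connectedComponentMk
  have hker : LinearMap.ker Φ ≤ LinearMap.range Ψ := by
    intro f hf
    have hab : ∀ i, f (a i) = f (b i) := fun i => by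
      have := congrFun (LinearMap.mem_ker.1 hf) i
      simpa [Φ, sub_eq_zero] using this
    have hadj : ∀ y z, L.Adj y z → f y = f z := by
      intro y z hyz
      obtain ⟨i, ⟨rfl, rfl⟩ | ⟨rfl, rfl⟩⟩ := hL y z hyz
      · exact hab i
      · exact (hab i).symm
    have hwalk : ∀ (y z : V) (p : L.Walk y z), f y = f z := by
      intro y z p
      induction p with
      | nil => rfl
      | cons h _ ih => exact (hadj _ _ h).trans ih
    refine ⟨fun q => q.lift f fun y z p _ => hwalk y z p, ?_⟩
    ext x
    rfl
  have h1 := LinearMap.finrank_range_add_finrank_ker Φ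
  have h2 : Module.finrank ℚ (LinearMap.range Φ) ≤ Nat.card ι := by
    refine (Submodule.finrank_le _).trans ?_
    rw [Module.finrank_fintype_fun_eq_card, Nat.card_eq_fintype_card]
  have h3 : Module.finrank ℚ (LinearMap.ker Φ) ≤ Nat.card L.ConnectedComponent := by
    refine (Submodule.finrank_mono hker).trans ((LinearMap.finrank_range_le Ψ).trans ?_)
    rw [Module.finrank_fintype_fun_eq_card, Nat.card_eq_fintype_card]
  rw [Module.finrank_fintype_fun_eq_card, ← Nat.card_eq_fintype_card] at h1
  omega

variable {V : Type*} {G : SimpleGraph V}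

/-- Two vertices are linked if they are the two neighbors of a vertex of degree two. -/
def degreeTwoLink (G : SimpleGraph V) : SimpleGraph V :=
  SimpleGraph.fromRel fun y z => ∃ x, (G.neighborSet x).ncard = 2 ∧ G.Adj x y ∧ G.Adj x z

/-- The class of a vertex under the equivalence relation generated by links. -/
def linkClass (G : SimpleGraph V) (x : V) : (degreeTwoLink G).ConnectedComponent :=
  (degreeTwoLink G).connectedComponentMk x

theorem linkClass_eq {x y z : V} (hx : (G.neighborSet x).ncard = 2) (hy : G.Adj x y)
    (hz : G.Adj x z) : linkClass G y = linkClass G z := by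
  by_cases hyz : y = z
  · rw [hyz]
  · refine ConnectedComponent.sound (Adj.reachable ?_)
    exact (SimpleGraph.fromRel_adj _ _ _).2 ⟨hyz, Or.inl ⟨x, hx, hy, hz⟩⟩

/-- There are at least as many classes as vertices of degree different from two. -/
theorem card_le_card_linkClass [Fintype V] :
    Nat.card {x : V // (G.neighborSet x).ncard ≠ 2} ≤
      Nat.card (degreeTwoLink G).ConnectedComponent := by
  classical
  have hex : ∀ x : {x : V // (G.neighborSet x).ncard = 2}, ∃ ab : V × V, ab.1 ≠ ab.2 ∧
      G.neighborSet x.1 = {ab.1, ab.2} := fun x => by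
    obtain ⟨a, b, hab, h⟩ := Set.ncard_eq_two.1 x.2
    exact ⟨(a, b), hab, h⟩
  choose ab hab hN using hex
  have h1 := card_le_card_connectedComponent_add (L := degreeTwoLink G)
    (fun x => (ab x).1) (fun x => (ab x).2) (by
      have key : ∀ y z, y ≠ z → (∃ x, (G.neighborSet x).ncard = 2 ∧ G.Adj x y ∧ G.Adj x z) →
          ∃ i, ((ab i).1 = y ∧ (ab i).2 = z) ∨ ((ab i).1 = z ∧ (ab i).2 = y) := by
        rintro y z hne ⟨x, hx, hy, hz⟩
        have hy' : y ∈ G.neighborSet x := hy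
        have hz' : z ∈ G.neighborSet x := hz
        rw [hN ⟨x, hx⟩] at hy' hz'
        refine ⟨⟨x, hx⟩, ?_⟩
        rcases hy' with h | h <;> rcases hz' with h' | h'
        · exact absurd (h.trans h'.symm) hne
        · exact Or.inl ⟨h.symm, h'.symm⟩
        · exact Or.inr ⟨h'.symm, h.symm⟩
        · exact absurd (h.trans h'.symm) hne
      intro y z hyz
      obtain ⟨hne, h | h⟩ := (SimpleGraph.fromRel_adj _ _ _).1 hyz
      · exact key y z hne h
      · obtain ⟨i, hi⟩ := key z y hne.symm h
        exact ⟨i, hi.symm⟩)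
  have h2 := Fintype.card_subtype_compl (fun x : V => (G.neighborSet x).ncard = 2)
  have h3 := Fintype.card_subtype_le (fun x : V => (G.neighborSet x).ncard = 2)
  rw [Nat.card_eq_fintype_card, Nat.card_eq_fintype_card (α := {x : V // _ = 2})] at h1
  rw [Nat.card_eq_fintype_card]
  simp only [ne_eq]
  omega

/-- The vertices of degree different from two, each with one exceptional neighbor `thin h`, are in
bijection with the link classes: all other neighbors of `h` are in the class `cls h`. -/
structure ThinEdges (G : SimpleGraph V) where
  cls : {x : V // (G.neighborSet x).ncard ≠ 2} ≃ (degreeTwoLink G).ConnectedComponent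
  thin : {x : V // (G.neighborSet x).ncard ≠ 2} → V
  adj_thin : ∀ h, G.Adj h.1 (thin h)
  linkClass_thin_ne : ∀ h, linkClass G (thin h) ≠ cls h
  linkClass_eq_of_ne_thin : ∀ h y, G.Adj h.1 y → y ≠ thin h → linkClass G y = cls h
  exists_two : ∀ h, ∃ y z, y ≠ z ∧ G.Adj h.1 y ∧ G.Adj h.1 z ∧ y ≠ thin h ∧ z ≠ thin h
  eq_univ_of_closed : ∀ T : Set (degreeTwoLink G).ConnectedComponent, T.Nonempty →
    (∀ h, cls h ∈ T → linkClass G (thin h) ∈ T) → T = Set.univ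

theorem exists_two_other_of_ncard_ne_two [Fintype V] {u w : V}
    (hu : (G.neighborSet u).ncard ≠ 2) (htwo : ∃ a b, a ≠ b ∧ G.Adj u a ∧ G.Adj u b)
    (huw : G.Adj u w) : ∃ y z, y ≠ z ∧ G.Adj u y ∧ G.Adj u z ∧ y ≠ w ∧ z ≠ w := by
  obtain ⟨y, hy, hyw⟩ : ∃ y, G.Adj u y ∧ y ≠ w := by
    obtain ⟨a, b, hab, ha, hb⟩ := htwo
    by_cases haw : a = w
    · exact ⟨b, hb, fun h => hab (haw.trans h.symm)⟩
    · exact ⟨a, ha, haw⟩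
  obtain ⟨z, hz, hzw, hzy⟩ : ∃ z, G.Adj u z ∧ z ≠ w ∧ z ≠ y := by
    by_contra hcon
    push Not at hcon
    apply hu
    rw [Set.ncard_eq_two]
    refine ⟨y, w, hyw, Set.ext fun z => ⟨fun hz => ?_, ?_⟩⟩
    · by_cases hzw : z = w
      · exact Or.inr hzw
      · exact Or.inl (hcon z hz hzw)
    · rintro (rfl | rfl)
      · exact hy
      · exact huw
  exact ⟨y, z, hzy.symm, hy, hz, hyw, hzw⟩

/-- If the vertex set is the only skew fort and there are several link classes, then there is
a system of thin edges. -/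
theorem nonempty_thinEdges [Fintype V] [Nontrivial V] (hV : IsSkewFort G Set.univ)
    (hmin : ∀ F, IsSkewFort G F → F = Set.univ)
    [Nontrivial (degreeTwoLink G).ConnectedComponent] : Nonempty (ThinEdges G) := by
  classical
  -- The vertices with class outside `T` form a nonempty proper subset, hence no skew fort. A
  -- witness `u` is not of degree two, since then both its neighbors would have the same class.
  have hrow : ∀ T : Set (degreeTwoLink G).ConnectedComponent, T.Nonempty → T ≠ Set.univ →
      ∃ u w, G.Adj u w ∧ linkClass G w ∉ T ∧ (∀ y, G.Adj u y → y ≠ w → linkClass G y ∈ T) ∧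
        (G.neighborSet u).ncard ≠ 2 := by
    intro T hT hTu
    have hne : {x | linkClass G x ∉ T}.Nonempty := by
      obtain ⟨q, hq⟩ := (Set.ne_univ_iff_exists_notMem T).1 hTu
      induction q using ConnectedComponent.ind with
      | _ x => exact ⟨x, hq⟩
    have hnf : ¬ IsSkewFort G {x | linkClass G x ∉ T} := by
      intro hF
      obtain ⟨q, hq⟩ := hT
      induction q using ConnectedComponent.ind with
      | _ x => exact ((hmin _ hF).symm.subset (Set.mem_univ x)) hq
    obtain ⟨u, w, hw, huw, huniq⟩ := exists_unique_adj_of_not_isSkewFort hne hnf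
    have hother : ∀ y, G.Adj u y → y ≠ w → linkClass G y ∈ T := by
      intro y hy hyw
      by_contra h
      exact hyw (huniq y h hy)
    refine ⟨u, w, huw, hw, hother, fun hu => ?_⟩
    obtain ⟨a, b, hab, ha, hb⟩ := exists_two_adj_of_minimal hV hmin u
    by_cases haw : a = w
    · have := hother b hb fun h => hab (haw.trans h.symm)
      rw [linkClass_eq hu hb huw] at this
      exact hw this
    · have := hother a ha haw
      rw [linkClass_eq hu ha huw] at this
      exact hw this
  have hrow1 : ∀ q : (degreeTwoLink G).ConnectedComponent,
      ∃ uw : {x : V // (G.neighborSet x).ncard ≠ 2} × V, G.Adj uw.1.1 uw.2 ∧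
        linkClass G uw.2 ≠ q ∧ ∀ y, G.Adj uw.1.1 y → y ≠ uw.2 → linkClass G y = q := by
    intro q
    obtain ⟨q', hq'⟩ := exists_ne q
    obtain ⟨u, w, h1, h2, h3, h4⟩ := hrow {q} (Set.singleton_nonempty q)
      fun h => hq' (h.symm.subset (Set.mem_univ q'))
    exact ⟨(⟨u, h4⟩, w), h1, h2, h3⟩
  choose uw hadj hne hother using hrow1
  -- A branch vertex has at least three neighbors, so one of them is exceptional for neither
  -- description.
  have huniq : ∀ (u w w' : V) (T T' : Set (degreeTwoLink G).ConnectedComponent),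
      (G.neighborSet u).ncard ≠ 2 → G.Adj u w → G.Adj u w' →
      (∀ y, G.Adj u y → y ≠ w → linkClass G y ∈ T) →
      (∀ y, G.Adj u y → y ≠ w' → linkClass G y ∈ T') → (T ∩ T').Nonempty := by
    intro u w w' T T' hu hw hw' h h'
    obtain ⟨y, z, hyz, hy, hz, hyw, hzw⟩ := exists_two_other_of_ncard_ne_two hu
      (exists_two_adj_of_minimal hV hmin u) hw
    by_cases hyw' : y = w'
    · exact ⟨_, h z hz hzw, h' z hz fun h => hyz (hyw'.trans h.symm)⟩
    · exact ⟨_, h y hy hyw, h' y hy hyw'⟩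
  have hinj : Function.Injective fun q => (uw q).1 := by
    intro q q' hqq
    simp only at hqq
    obtain ⟨r, h1, h2⟩ := huniq (uw q).1.1 (uw q).2 (uw q').2 {q} {q'} (uw q).1.2 (hadj q)
      (hqq ▸ hadj q') (hother q) (fun y hy hyw => hother q' y (hqq ▸ hy) hyw)
    exact h1.symm.trans h2
  -- An injection from classes to branch vertices, of which there are no more than classes.
  have hbij : Function.Bijective fun q => (uw q).1 := by
    rw [Fintype.bijective_iff_injective_and_card]
    refine ⟨hinj, le_antisymm (Fintype.card_le_of_injective _ hinj) ?_⟩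
    have := card_le_card_linkClass (G := G)
    rwa [Nat.card_eq_fintype_card, Nat.card_eq_fintype_card] at this
  let e := Equiv.ofBijective _ hbij
  have he : ∀ h, (uw (e.symm h)).1 = h := fun h => e.apply_symm_apply h
  refine ⟨⟨e.symm, fun h => (uw (e.symm h)).2, fun h => ?_, fun h => hne _, fun h y hy hyt => ?_,
    fun h => ?_, fun T hT hcl => ?_⟩⟩
  · have := hadj (e.symm h)
    rwa [he] at this
  · refine hother (e.symm h) y ?_ hyt
    rwa [he]
  · refine exists_two_other_of_ncard_ne_two h.2 (exists_two_adj_of_minimal hV hmin _) ?_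
    have := hadj (e.symm h)
    rwa [he] at this
  · by_contra hTu
    obtain ⟨u, w, huw, hwT, hoth, hu⟩ := hrow T hT hTu
    have ha := hadj (e.symm ⟨u, hu⟩)
    have ho := hother (e.symm ⟨u, hu⟩)
    have hc := hcl ⟨u, hu⟩
    rw [he] at ha ho
    set q := e.symm ⟨u, hu⟩ with hq
    obtain ⟨r, hr1, hr2⟩ := huniq u w (uw q).2 T {q} hu huw ha hoth ho
    have hqT : q ∈ T := hr2 ▸ hr1
    -- The exceptional neighbor `w` for `T` is either the thin one, whose class is in `T` by
    -- closure, or an ordinary one of class `q ∈ T`.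
    by_cases hww : w = (uw q).2
    · exact hwT (hww ▸ hc hqT)
    · exact hwT ((ho w huw hww).symm ▸ hqT)

end LinkClasses

/-! ### Threads pair the branch vertices -/

section Pairing

open SimpleGraph

variable {V : Type*} {G : SimpleGraph V}

/-- The vertices of degree different from two. -/
abbrev branchSet (G : SimpleGraph V) : Set V := {x | (G.neighborSet x).ncard ≠ 2}

theorem ncard_eq_two_of_notMem_branchSet (x : V) (hx : x ∉ branchSet G) :
    (G.neighborSet x).ncard = 2 := not_not.1 hx

theorem linkClass_eq_of_notMem_branchSet (x : V) (hx : x ∉ branchSet G) (y z : V)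
    (hy : G.Adj x y) (hz : G.Adj x z) : linkClass G y = linkClass G z :=
  linkClass_eq (ncard_eq_two_of_notMem_branchSet x hx) hy hz

namespace ThinEdges

variable [Fintype V]

/-- The map taking the class of `h` to that of its thin neighbor is surjective, its range being
closed in the sense of `eq_univ_of_closed`; finiteness does the rest. -/
theorem linkClass_thin_injective (E : ThinEdges G) : Function.Injective fun h => linkClass G (E.thin h) := by
  classical
  have hsurj : Function.Surjective fun q => linkClass G (E.thin (E.cls.symm q)) := by
    intro q
    have := E.eq_univ_of_closed (Set.range fun q => linkClass G (E.thin (E.cls.symm q)))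
      ⟨_, q, rfl⟩ fun h _ => ⟨E.cls h, by simp⟩
    exact this.symm.subset (Set.mem_univ q)
  have hinj := Finite.injective_iff_surjective.2 hsurj
  intro h h' heq
  apply E.cls.injective
  apply hinj
  simpa using heq

/-- Every link class contains a branch vertex. -/
theorem linkClass_surjective (E : ThinEdges G)
    (hmin : ∀ F, IsSkewFort G F → F = Set.univ) :
    Function.Surjective fun h : {x : V // (G.neighborSet x).ncard ≠ 2} => linkClass G h.1 := by
  intro q
  obtain ⟨h, rfl⟩ := E.cls.surjective q
  obtain ⟨y₁, y₂, hne, ha₁, ha₂, hy₁, hy₂⟩ := E.exists_two h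
  have hdeg := ncard_eq_two_of_notMem_branchSet (G := G)
  -- An odd thread through `y` ends in the desired class. An even one must arrive by a thin edge, as
  -- otherwise its end would correspond to the same class as `h` and it would be a closed even
  -- thread. Two such arrivals would share the thin edge and hence coincide.
  have key : ∀ y, G.Adj h.1 y → y ≠ E.thin h →
      (∃ b : {x : V // (G.neighborSet x).ncard ≠ 2}, linkClass G b.1 = E.cls h) ∨
      ∃ (b : {x : V // (G.neighborSet x).ncard ≠ 2}) (p : G.Walk h.1 b.1),
        IsThread (branchSet G) p ∧ p.getVert 1 = y ∧ p.getVert (p.length - 1) = E.thin b ∧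
        linkClass G (E.thin b) = E.cls h := by
    intro y hy hyt
    obtain ⟨t, p, hp, h1, -⟩ := exists_isThread hdeg h.2 hy
    have hcy := E.linkClass_eq_of_ne_thin h y hy hyt
    rcases Nat.even_or_odd p.length with he | ho
    · right
      have hpred := hp.apply_pred_of_even he linkClass_eq_of_notMem_branchSet
      rw [h1, hcy] at hpred
      refine ⟨⟨t, hp.end_mem⟩, p, hp, h1, ?_⟩
      have hthin : p.getVert (p.length - 1) = E.thin ⟨t, hp.end_mem⟩ := by
        by_contra hcon
        have h2 := E.linkClass_eq_of_ne_thin ⟨t, hp.end_mem⟩ _ hp.adj_end hcon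
        have h3 := E.cls.injective (hpred.symm.trans h2)
        obtain ⟨h, hh⟩ := h
        obtain rfl : h = t := congrArg Subtype.val h3
        exact Nat.not_even_iff_odd.2 (hp.odd_of_isCycle hdeg (hp.isCycle hdeg) hmin) he
      exact ⟨hthin, hthin ▸ hpred⟩
    · left
      refine ⟨⟨t, hp.end_mem⟩, ?_⟩
      have := hp.apply_end_of_odd ho linkClass_eq_of_notMem_branchSet
      rw [h1, hcy] at this
      exact this
  rcases key y₁ ha₁ hy₁ with hb | ⟨b₁, p₁, hp₁, h11, h12, h13⟩
  · exact hb
  rcases key y₂ ha₂ hy₂ with hb | ⟨b₂, p₂, hp₂, h21, h22, h23⟩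
  · exact hb
  exfalso
  obtain rfl := E.linkClass_thin_injective (h13.trans h23.symm)
  exact hne (h11.symm.trans ((hp₁.getVert_one_eq hdeg hp₂ (h12.trans h22.symm)).2.trans h21))

theorem linkClass_injective (E : ThinEdges G)
    (hmin : ∀ F, IsSkewFort G F → F = Set.univ) :
    Function.Injective fun h : {x : V // (G.neighborSet x).ncard ≠ 2} => linkClass G h.1 := by
  classical
  have hs : Function.Surjective fun h : {x : V // (G.neighborSet x).ncard ≠ 2} =>
      E.cls.symm (linkClass G h.1) := E.cls.symm.surjective.comp (E.linkClass_surjective hmin)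
  have hi := Finite.injective_iff_surjective.2 hs
  exact fun a b hab => hi (congrArg E.cls.symm hab)

/-- The ends of an even thread have the same class, hence coincide, and closed threads are odd. -/
theorem odd_length (E : ThinEdges G)
    (hmin : ∀ F, IsSkewFort G F → F = Set.univ) {s t : V} {p : G.Walk s t} (hp : IsThread (branchSet G) p) :
    Odd p.length := by
  rw [← Nat.not_even_iff_odd]
  intro he
  have hdeg := ncard_eq_two_of_notMem_branchSet (G := G)
  have h1 := hp.apply_end_of_even he linkClass_eq_of_notMem_branchSet
  have h2 : (⟨t, hp.end_mem⟩ : {x : V // (G.neighborSet x).ncard ≠ 2}) = ⟨s, hp.start_mem⟩ :=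
    E.linkClass_injective hmin h1
  obtain rfl : t = s := congrArg Subtype.val h2
  exact Nat.not_even_iff_odd.2 (hp.odd_of_isCycle hdeg (hp.isCycle hdeg) hmin) he

/-- The threads pair the branch vertices in two ways: `ρ h` is the common end of the threads that
leave `h` by an ordinary edge, and `θ h` is the end of the one that leaves by the thin edge. -/
theorem exists_pairing (E : ThinEdges G)
    (hmin : ∀ F, IsSkewFort G F → F = Set.univ) :
    ∃ ρ θ : {x : V // (G.neighborSet x).ncard ≠ 2} → {x : V // (G.neighborSet x).ncard ≠ 2},
      Function.Involutive ρ ∧ Function.Involutive θ ∧ (∀ h, θ h ≠ h) ∧ (∀ h, ρ h ≠ θ h) ∧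
      (∀ T : Set {x : V // (G.neighborSet x).ncard ≠ 2}, T.Nonempty →
        (∀ h ∈ T, ρ (θ h) ∈ T) → T = Set.univ) ∧
      ∀ (h : {x : V // (G.neighborSet x).ncard ≠ 2}) (t : V) (p : G.Walk h.1 t),
        IsThread (branchSet G) p → (p.getVert 1 ≠ E.thin h → t = ρ h) ∧
          (p.getVert 1 = E.thin h → t = θ h) := by
  have hdeg := ncard_eq_two_of_notMem_branchSet (G := G)
  let π : {x : V // (G.neighborSet x).ncard ≠ 2} ≃ (degreeTwoLink G).ConnectedComponent :=
    Equiv.ofBijective _ ⟨E.linkClass_injective hmin, E.linkClass_surjective hmin⟩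
  have hπ : ∀ h, π h = linkClass G h.1 := fun h => rfl
  -- An odd thread ends at the branch vertex in the class of its first inner vertex (or of that end
  -- itself, for length one); this dictates both maps.
  let ρ : {x : V // (G.neighborSet x).ncard ≠ 2} → {x : V // (G.neighborSet x).ncard ≠ 2} :=
    fun h => π.symm (E.cls h)
  let θ : {x : V // (G.neighborSet x).ncard ≠ 2} → {x : V // (G.neighborSet x).ncard ≠ 2} :=
    fun h => π.symm (linkClass G (E.thin h))
  have hρ : ∀ h, linkClass G (ρ h).1 = E.cls h := fun h => π.apply_symm_apply _
  have hθ : ∀ h, linkClass G (θ h).1 = linkClass G (E.thin h) := fun h => π.apply_symm_apply _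
  have hthread : ∀ (h : {x : V // (G.neighborSet x).ncard ≠ 2}) y, G.Adj h.1 y →
      ∃ (b : {x : V // (G.neighborSet x).ncard ≠ 2}) (p : G.Walk h.1 b.1),
        IsThread (branchSet G) p ∧ p.getVert 1 = y ∧ linkClass G b.1 = linkClass G y ∧
        linkClass G (p.getVert (p.length - 1)) = linkClass G h.1 := by
    intro h y hy
    obtain ⟨t, p, hp, h1, -⟩ := exists_isThread hdeg h.2 hy
    have ho := E.odd_length hmin hp
    refine ⟨⟨t, hp.end_mem⟩, p, hp, h1, ?_, ?_⟩
    · have := hp.apply_end_of_odd ho linkClass_eq_of_notMem_branchSet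
      rwa [h1] at this
    · exact hp.apply_pred_of_odd ho linkClass_eq_of_notMem_branchSet
  have hend : ∀ (b b' : {x : V // (G.neighborSet x).ncard ≠ 2}),
      linkClass G b.1 = linkClass G b'.1 → b = b' := fun b b' h => E.linkClass_injective hmin h
  -- Two different threads join `h` to `ρ h` by ordinary edges at `h`. They cannot both arrive by
  -- the thin edge of `ρ h`, so one arrives by an ordinary edge, through a vertex of the class of
  -- `h`.
  have hfat : ∀ h, linkClass G h.1 = E.cls (ρ h) := by
    intro h
    obtain ⟨y₁, y₂, hne, ha₁, ha₂, hy₁, hy₂⟩ := E.exists_two h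
    obtain ⟨b₁, p₁, hp₁, h11, h12, h13⟩ := hthread h y₁ ha₁
    obtain ⟨b₂, p₂, hp₂, h21, h22, h23⟩ := hthread h y₂ ha₂
    rw [E.linkClass_eq_of_ne_thin h _ ha₁ hy₁, ← hρ] at h12
    rw [E.linkClass_eq_of_ne_thin h _ ha₂ hy₂, ← hρ] at h22
    obtain rfl := hend _ _ h12
    obtain rfl := hend _ _ h22
    by_contra hcon
    have ht₁ : p₁.getVert (p₁.length - 1) = E.thin (ρ h) := by
      by_contra h
      exact hcon (h13.symm.trans (E.linkClass_eq_of_ne_thin _ _ hp₁.adj_end h))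
    have ht₂ : p₂.getVert (p₂.length - 1) = E.thin (ρ h) := by
      by_contra h
      exact hcon (h23.symm.trans (E.linkClass_eq_of_ne_thin _ _ hp₂.adj_end h))
    exact hne (h11.symm.trans ((hp₁.getVert_one_eq hdeg hp₂ (ht₁.trans ht₂.symm)).2.trans h21))
  have hρinv : Function.Involutive ρ := fun h => hend _ _ (by rw [hρ, ← hfat])
  -- Arrival by an ordinary edge would give `h = ρ b`, and then the thin neighbor of `h` would have
  -- the class of the ordinary ones.
  have hthinpred : ∀ (h b : {x : V // (G.neighborSet x).ncard ≠ 2}) (p : G.Walk h.1 b.1),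
      IsThread (branchSet G) p → p.getVert 1 = E.thin h →
      p.getVert (p.length - 1) = E.thin b := by
    intro h b p hp h1
    by_contra hcon
    have ho := E.odd_length hmin hp
    have h2 := E.linkClass_eq_of_ne_thin _ _ hp.adj_end hcon
    rw [hp.apply_pred_of_odd ho linkClass_eq_of_notMem_branchSet, ← hρ b] at h2
    obtain rfl := hend _ _ h2
    have h3 := hp.apply_end_of_odd ho linkClass_eq_of_notMem_branchSet
    rw [h1, hfat] at h3
    exact E.linkClass_thin_ne _ h3.symm
  have hθthread : ∀ h, ∃ p : G.Walk h.1 (θ h).1, IsThread (branchSet G) p ∧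
      p.getVert 1 = E.thin h ∧ p.getVert (p.length - 1) = E.thin (θ h) := by
    intro h
    obtain ⟨b, p, hp, h1, h2, -⟩ := hthread h _ (E.adj_thin h)
    rw [← hθ] at h2
    obtain rfl := hend _ _ h2
    exact ⟨p, hp, h1, hthinpred h _ p hp h1⟩
  have hθinv : Function.Involutive θ := by
    intro h
    obtain ⟨p, hp, h1, h2⟩ := hθthread h
    apply hend
    rw [hθ, ← h2]
    exact hp.apply_pred_of_odd (E.odd_length hmin hp) linkClass_eq_of_notMem_branchSet
  refine ⟨ρ, θ, hρinv, hθinv, ?_, ?_, ?_, ?_⟩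
  -- A closed thin thread would leave and return by the same edge, which no cycle does.
  · intro h hfix
    have key : ∀ (b : {x : V // (G.neighborSet x).ncard ≠ 2}) (p : G.Walk h.1 b.1), b = h →
        IsThread (branchSet G) p → p.getVert 1 = p.getVert (p.length - 1) → False := by
      rintro b p rfl hp heq
      exact (hp.isCycle hdeg).snd_ne_penultimate heq
    obtain ⟨p, hp, h1, h2⟩ := hθthread h
    exact key _ p hfix hp (by rw [h1, h2, hfix])
  · intro h heq
    apply E.linkClass_thin_ne h
    rw [← hθ, ← heq, hρ]
  · intro T hT hcl
    -- Under `cls`, the step from `h` to `ρ (θ h)` becomes the step from the class of `h` to that of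
    -- its thin neighbor.
    have := E.eq_univ_of_closed (E.cls '' T) (hT.image _) (by
      rintro h ⟨h', hh', heq⟩
      obtain rfl := E.cls.injective heq
      exact ⟨ρ (θ h'), hcl h' hh', by rw [← hfat, hθ]⟩)
    refine Set.eq_univ_of_forall fun h => ?_
    obtain ⟨h', hh', heq⟩ := this.symm.subset (Set.mem_univ (E.cls h))
    exact E.cls.injective heq ▸ hh'
  · intro h t p hp
    have h1 := hp.apply_end_of_odd (E.odd_length hmin hp) linkClass_eq_of_notMem_branchSet
    refine ⟨fun hne => ?_, fun heq => ?_⟩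
    · rw [E.linkClass_eq_of_ne_thin h _ hp.adj_start hne, ← hρ] at h1
      exact congrArg Subtype.val (hend ⟨t, hp.end_mem⟩ _ h1)
    · rw [heq, ← hθ] at h1
      exact congrArg Subtype.val (hend ⟨t, hp.end_mem⟩ _ h1)

end ThinEdges

end Pairing

/-! ### Assembling the classification -/

section Main

open SimpleGraph

variable {V : Type*} {G : SimpleGraph V}

theorem IsThread.notMem_of_ne {H : Set V} {s t : V} {p : G.Walk s t} (hp : IsThread H p) {x : V}
    (hx : x ∈ p.support) (hs : x ≠ s) (ht : x ≠ t) : x ∉ H := by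
  obtain ⟨i, rfl, hi⟩ := Walk.mem_support_iff_exists_getVert.1 hx
  refine hp.notMem i (Nat.pos_of_ne_zero ?_) (lt_of_le_of_ne hi ?_)
  · rintro rfl
    simp at hs
  · rintro rfl
    simp at ht

/-- If the vertex set is the only skew fort and there are several link classes, the graph is
a doubly extended bouquet-dipole. -/
theorem isDoublyExtendedBouquetDipole_of_minimal [Fintype V] [Nontrivial V]
    (hV : IsSkewFort G Set.univ) (hmin : ∀ F, IsSkewFort G F → F = Set.univ)
    [Nontrivial (degreeTwoLink G).ConnectedComponent] : IsDoublyExtendedBouquetDipole G := by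
  obtain ⟨E⟩ := nonempty_thinEdges hV hmin
  obtain ⟨ρ, θ, hρ, hθ, hfix, hρθ, htrans, hends⟩ := E.exists_pairing hmin
  have : Nonempty {x : V // (G.neighborSet x).ncard ≠ 2} := by
    obtain ⟨x, -⟩ := exists_pair_ne V
    exact ⟨E.cls.symm (linkClass G x)⟩
  obtain ⟨m, s, hs, hs0, hsl, heven, hodd⟩ :=
    exists_alternating_enumeration ρ θ hρ hθ hfix htrans
  have hdeg := ncard_eq_two_of_notMem_branchSet (G := G)
  have hrange : ∀ x, x ∉ branchSet G → x ∉ Set.range (fun j => (s j).1) ∧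
      (G.neighborSet x).ncard = 2 := by
    intro x hx
    refine ⟨?_, hdeg x hx⟩
    rintro ⟨j, rfl⟩
    exact hx (s j).2
  have hne : ∀ j : Fin (2 * m + 1), (s j.castSucc).1 ≠ (s j.succ).1 := fun j h =>
    (Fin.castSucc_lt_succ (i := j)).ne (hs.1 (Subtype.ext h))
  have hthin : ∀ h h', θ h = h' → ∃ p : G.Walk h.1 h'.1, IsThread (branchSet G) p ∧
      p.getVert 1 = E.thin h := by
    rintro h _ rfl
    obtain ⟨t, p, hp, h1, -⟩ := exists_isThread hdeg h.2 (E.adj_thin h)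
    obtain rfl := (hends h t p hp).2 h1
    exact ⟨p, hp, h1⟩
  have hfat : ∀ h h', ρ h = h' → ∀ y, G.Adj h.1 y → y ≠ E.thin h →
      ∃ p : G.Walk h.1 h'.1, IsThread (branchSet G) p ∧ p.getVert 1 = y := by
    rintro h _ rfl y hy hyt
    obtain ⟨t, p, hp, h1, -⟩ := exists_isThread hdeg h.2 hy
    obtain rfl := (hends h t p hp).1 (h1 ▸ hyt)
    exact ⟨p, hp, h1⟩
  have hedge : ∀ e ∈ G.edgeSet,
      (∃ c : G.Walk (s 0).1 (s 0).1, IsThread (branchSet G) c ∧ e ∈ c.edges) ∨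
      (∃ d : G.Walk (s (Fin.last (2 * m + 1))).1 (s (Fin.last (2 * m + 1))).1,
        IsThread (branchSet G) d ∧ e ∈ d.edges) ∨
      ∃ (j : Fin (2 * m + 1)) (p : G.Walk (s j.castSucc).1 (s j.succ).1),
        IsThread (branchSet G) p ∧ e ∈ p.edges := by
    intro e he
    have hgood : ∀ (a b : Fin (2 * m + 1 + 1)) (p : G.Walk (s a).1 (s b).1),
        IsThread (branchSet G) p → e ∈ p.edges →
        ((a = 0 ∧ b = 0) ∨ (a = Fin.last (2 * m + 1) ∧ b = Fin.last (2 * m + 1)) ∨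
          (∃ j : Fin (2 * m + 1), a = j.castSucc ∧ b = j.succ) ∨
          ∃ j : Fin (2 * m + 1), a = j.succ ∧ b = j.castSucc) →
        (∃ c : G.Walk (s 0).1 (s 0).1, IsThread (branchSet G) c ∧ e ∈ c.edges) ∨
        (∃ d : G.Walk (s (Fin.last (2 * m + 1))).1 (s (Fin.last (2 * m + 1))).1,
          IsThread (branchSet G) d ∧ e ∈ d.edges) ∨
        ∃ (j : Fin (2 * m + 1)) (p : G.Walk (s j.castSucc).1 (s j.succ).1),
          IsThread (branchSet G) p ∧ e ∈ p.edges := by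
      rintro a b p hp hep (⟨rfl, rfl⟩ | ⟨rfl, rfl⟩ | ⟨j, rfl, rfl⟩ | ⟨j, rfl, rfl⟩)
      · exact Or.inl ⟨p, hp, hep⟩
      · exact Or.inr (Or.inl ⟨p, hp, hep⟩)
      · exact Or.inr (Or.inr ⟨j, p, hp, hep⟩)
      · exact Or.inr (Or.inr ⟨j, p.reverse, hp.reverse, by simpa using hep⟩)
    have hth : ∃ (u v : V) (p : G.Walk u v), IsThread (branchSet G) p ∧ e ∈ p.edges := by
      induction e using Sym2.ind with
      | _ x y =>
        exact exists_isThread_of_adj hdeg ⟨(s 0).1, (s 0).2⟩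
          (fun T hne hT => eq_univ_of_closed_of_minimal hV hmin hne hT) he
    obtain ⟨u, v, p, hp, hep⟩ := hth
    obtain ⟨a, ha⟩ := hs.2 ⟨u, hp.start_mem⟩
    obtain ⟨b, hb⟩ := hs.2 ⟨v, hp.end_mem⟩
    obtain rfl : (s a).1 = u := congrArg Subtype.val ha
    obtain rfl : (s b).1 = v := congrArg Subtype.val hb
    refine hgood a b p hp hep ?_
    have hab := hends (s a) _ p hp
    by_cases h1 : p.getVert 1 = E.thin (s a)
    · have hb : s b = θ (s a) := Subtype.ext (hab.2 h1)
      right; right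
      rcases Nat.even_or_odd (a : ℕ) with ha | ha
      · have hal : a ≠ Fin.last (2 * m + 1) := by
          rintro rfl
          rw [Fin.val_last] at ha
          exact Nat.not_even_iff_odd.2 ⟨m, rfl⟩ ha
        obtain ⟨j, rfl⟩ := Fin.exists_castSucc_eq.2 hal
        rw [heven j ha] at hb
        exact Or.inl ⟨j, rfl, hs.1 hb⟩
      · have ha0 : a ≠ 0 := by
          rintro rfl
          simp at ha
        obtain ⟨j, rfl⟩ := Fin.exists_succ_eq.2 ha0
        have hj : Even (j : ℕ) := by
          rw [Fin.val_succ] at ha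
          by_contra h
          exact Nat.not_even_iff_odd.2 ha (Nat.not_even_iff_odd.1 h).add_one
        rw [← heven j hj, hθ] at hb
        exact Or.inr ⟨j, rfl, hs.1 hb⟩
    · have hb : s b = ρ (s a) := Subtype.ext (hab.1 h1)
      by_cases ha0 : a = 0
      · subst ha0
        exact Or.inl ⟨rfl, hs.1 (hb.trans hs0)⟩
      by_cases hal : a = Fin.last (2 * m + 1)
      · subst hal
        exact Or.inr (Or.inl ⟨rfl, hs.1 (hb.trans hsl)⟩)
      right; right
      rcases Nat.even_or_odd (a : ℕ) with ha | ha
      · obtain ⟨j, rfl⟩ := Fin.exists_succ_eq.2 ha0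
        have hj : Odd (j : ℕ) := by
          rw [Fin.val_succ] at ha
          by_contra h
          exact Nat.not_even_iff_odd.2 (Nat.not_odd_iff_even.1 h).add_one ha
        rw [← hodd j hj, hρ] at hb
        exact Or.inr ⟨j, rfl, hs.1 hb⟩
      · obtain ⟨j, rfl⟩ := Fin.exists_castSucc_eq.2 hal
        rw [hodd j ha] at hb
        exact Or.inl ⟨j, rfl, hs.1 hb⟩
  -- All threads between the prescribed ends are taken. Cycles thus occur in both orientations,
  -- which the definition of the dipole permits.
  refine ⟨m, fun j => (s j).1, {c | IsThread (branchSet G) c}, {d | IsThread (branchSet G) d},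
    fun j => {p | IsThread (branchSet G) p}, fun a b h => hs.1 (Subtype.ext h), ?_, ?_, ?_, ?_, ?_,
    ?_, ?_, ?_, hedge⟩
  · obtain ⟨y, -, -, hy, -, hyt, -⟩ := E.exists_two (s 0)
    obtain ⟨p, hp, -⟩ := hfat _ _ hs0 y hy hyt
    exact ⟨p, hp⟩
  · obtain ⟨y, -, -, hy, -, hyt, -⟩ := E.exists_two (s (Fin.last (2 * m + 1)))
    obtain ⟨p, hp, -⟩ := hfat _ _ hsl y hy hyt
    exact ⟨p, hp⟩
  · exact fun c hc => ⟨hc.isCycle hdeg, E.odd_length hmin hc,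
      fun x hx hne => hrange x (hc.notMem_of_ne hx hne hne)⟩
  · exact fun c hc => ⟨hc.isCycle hdeg, E.odd_length hmin hc,
      fun x hx hne => hrange x (hc.notMem_of_ne hx hne hne)⟩
  · exact fun j p hp => ⟨hp.isPath hdeg (hne j), E.odd_length hmin hp,
      fun x hx h1 h2 => hrange x (hp.notMem_of_ne hx h1 h2)⟩
  · intro j hj
    obtain ⟨p, hp, h1⟩ := hthin _ _ (heven j hj)
    refine ⟨p, Set.eq_singleton_iff_unique_mem.2 ⟨hp, fun q hq => ?_⟩⟩
    refine IsThread.eq_of_getVert_one hdeg hq hp ?_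
    by_contra hcon
    rw [h1] at hcon
    -- A second thread would leave by an ordinary edge and end at `ρ (s j)`, which differs from `θ
    -- (s j)`.
    have h2 := (hends (s j.castSucc) _ q hq).1 hcon
    exact hρθ (s j.castSucc) (by rw [heven j hj]; exact Subtype.ext h2.symm)
  · intro j hj
    obtain ⟨y, z, hyz, hy, hz, hyt, hzt⟩ := E.exists_two (s j.castSucc)
    obtain ⟨p, hp, hpy⟩ := hfat _ _ (hodd j hj) y hy hyt
    obtain ⟨q, hq, hqz⟩ := hfat _ _ (hodd j hj) z hz hzt
    refine ⟨p, hp, q, hq, ?_⟩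
    rintro rfl
    exact hyz (hpy.symm.trans hqz)
  · intro x
    obtain ⟨a, b, -, ha, -⟩ := exists_two_adj_of_minimal hV hmin x
    rcases hedge s(x, a) ha with ⟨c, hc, he⟩ | ⟨d, hd, he⟩ | ⟨j, p, hp, he⟩
    · exact Or.inl ⟨c, hc, c.fst_mem_support_of_mem_edges he⟩
    · exact Or.inr (Or.inl ⟨d, hd, d.fst_mem_support_of_mem_edges he⟩)
    · exact Or.inr (Or.inr ⟨j, p, hp, p.fst_mem_support_of_mem_edges he⟩)

/-- The graphs on at least two vertices whose only skew fort is the vertex set. -/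
theorem dipole_or_bouquet_of_minimal [Fintype V] [Nontrivial V]
    (hV : IsSkewFort G Set.univ) (hmin : ∀ F, IsSkewFort G F → F = Set.univ) :
    IsDoublyExtendedBouquetDipole G ∨ IsOddCycleBouquet G := by
  classical
  rcases subsingleton_or_nontrivial (degreeTwoLink G).ConnectedComponent with hQ | hQ
  · right
    -- One class allows at most one branch vertex; if there is none, any vertex can serve as the
    -- center.
    have hle : Nat.card {x : V // (G.neighborSet x).ncard ≠ 2} ≤ 1 :=
      card_le_card_linkClass.trans (by
        rw [Nat.card_eq_fintype_card]
        exact Fintype.card_le_one_iff_subsingleton.2 hQ)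
    rw [Nat.card_eq_fintype_card, Fintype.card_le_one_iff_subsingleton] at hle
    obtain ⟨c, hc⟩ : ∃ c : V, ∀ x, (G.neighborSet x).ncard ≠ 2 → x = c := by
      by_cases h : ∃ c : V, (G.neighborSet c).ncard ≠ 2
      · obtain ⟨c, hc⟩ := h
        exact ⟨c, fun x hx => congrArg Subtype.val (hle.elim ⟨x, hx⟩ ⟨c, hc⟩)⟩
      · obtain ⟨c, -⟩ := exists_pair_ne V
        exact ⟨c, fun x hx => absurd ⟨x, hx⟩ h⟩
    exact isOddCycleBouquet_of_minimal hV hmin c fun x hx => by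
      by_contra h
      exact hx (hc x h)
  · left
    exact isDoublyExtendedBouquetDipole_of_minimal hV hmin

theorem skewZeroForcingSpan_eq_zero_of_minimal [Fintype V] [DecidableEq V]
    (h : ∀ F, IsSkewFort G F ↔ F = Set.univ) : skewZeroForcingSpan G = 0 := by
  rw [skewZeroForcingSpan_eq_zero_iff]
  right
  obtain ⟨x, -⟩ := ((h Set.univ).2 rfl).1
  refine ⟨Fintype.card V, Fintype.card_pos_iff.2 ⟨x⟩, le_rfl, fun S hS => ?_, fun S hS => ?_⟩
  · rw [h, Finset.card_eq_iff_eq_univ S |>.1 hS, Finset.coe_univ]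
  · rw [h, Finset.coe_eq_univ] at hS
    rw [hS, Finset.card_univ]

end Main

theorem mainTheorem4 {V : Type*} [Fintype V] [DecidableEq V] (G : SimpleGraph V) :
    skewZeroForcingSpan G = 0 ↔
      G = ⊤ ∨ G = ⊥ ∨ IsDoublyExtendedBouquetDipole G ∨ IsOddCycleBouquet G ∨
        IsTwoSetPerfectlyOrderable G := by
  classical
  constructor
  · intro h
    rw [skewZeroForcingSpan_eq_zero_iff] at h
    rcases h with hno | ⟨f, hf1, hfn, hall, hmin⟩
    · exact Or.inr (Or.inr (Or.inr (Or.inr (forall_not_isSkewFort_iff.1 hno))))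
    rcases hf1.eq_or_lt with rfl | hf2
    · right; left
      ext a b
      simp only [SimpleGraph.bot_adj, iff_false]
      intro hab
      obtain ⟨c, hc, hne, -⟩ := (hall {b} (Finset.card_singleton b)).2 a b (by simp) hab
      simp at hc
      exact hne hc
    rcases hfn.eq_or_lt with hfn | hfn
    · have : Nontrivial V := Fintype.one_lt_card_iff_nontrivial.1 (hfn ▸ hf2)
      have hV : IsSkewFort G Set.univ := by
        have := hall Finset.univ (by rw [Finset.card_univ, hfn])
        rwa [Finset.coe_univ] at this
      have hmin' : ∀ F, IsSkewFort G F → F = Set.univ := by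
        intro F hF
        have h1 := hmin F.toFinset (by simpa using hF)
        rw [hfn] at h1
        have h2 := (Finset.card_eq_iff_eq_univ _).1 (le_antisymm (Finset.card_le_univ _) h1)
        rwa [Set.toFinset_eq_univ] at h2
      rcases dipole_or_bouquet_of_minimal hV hmin' with h | h
      · exact Or.inr (Or.inr (Or.inl h))
      · exact Or.inr (Or.inr (Or.inr (Or.inl h)))
    · exact Or.inl (eq_top_of_uniform hf2 hfn hall hmin)
  · rintro (rfl | rfl | h | h | h)
    · exact skewZeroForcingSpan_top
    · exact skewZeroForcingSpan_bot
    · exact skewZeroForcingSpan_eq_zero_of_minimal h.isSkewFort_iff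
    · exact skewZeroForcingSpan_eq_zero_of_minimal h.isSkewFort_iff
    · rw [skewZeroForcingSpan_eq_zero_iff]
      exact Or.inl (forall_not_isSkewFort_iff.2 h)
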